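/- Write $\mathcal D'(\mathbb R^3)$ for the complex-valued distributions on $\mathbb R^3$, $\mathcal E'(\mathbb R^3)$ for those with compact support, $\Delta=\partial_1^2+\partial_2^2+\partial_3^2$, and $$P(\partial)=\tfrac23\,\partial_3^2-\tfrac13\,(\partial_1^2+\partial_2^2),\qquad p(\xi)=-\xi_3^2+\tfrac13|\xi|^2 .$$ Let $\Sigma=\{(x,\xi)\in\mathbb R^3\times\mathbb R^3: p(\xi)=0\}$ be the characteristic set. For $u\in\mathcal D'(\mathbb R^3)$ let $\operatorname{singsupp}(u)$ be the set of points that have no open neighbourhood on which $u$ is given by a $C^\infty$ function, and let $\operatorname{WF}(u)\subset \mathbb R^3\times(\mathbb R^3\setminus\{0\})$ be the wave front set: for $\xi_0\neq 0$, $(x_0,\xi_0)\notin\operatorname{WF}(u)$ if and only if there are a real-valued $\theta\in C_0^\infty(\mathbb R^3)$ with $\theta(x_0)\neq0$ and an open conic neighbourhood $V$ of $\xi_0$ such that for every $N$ there is $C_N$ with $|\widehat{\theta u}(\xi)|\le C_N(1+|\xi|)^{-N}$ for all $\xi\in V$. Suppose $\psi\in\mathcal E'(\mathbb R^3)$ and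 $\operatorname{WF}(\psi)\cap\Sigma=\emptyset$. Then there exists $\chi\in\mathcal D'(\mathbb R^3)$ with $$P(\partial)\chi=-\Delta\psi$$ in the sense of distributions, such that $\operatorname{singsupp}(\chi)\subset\operatorname{singsupp}(\psi)$; moreover $\operatorname{singsupp}(\chi)$ and $\operatorname{singsupp}(\psi)$ are compact. -/

import Mathlib

open MeasureTheory TopologicalSpace
open scoped Distributions ContDiff LineDeriv

namespace QSM

/-- Euclidean three-space `ℝ³`. The coordinates `x₁, x₂, x₃` are `x 0, x 1, x 2`. -/
abbrev R3 : Type := EuclideanSpace ℝ (Fin 3)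

/-- Real-valued test functions on `ℝ³`. A complex-valued distribution is determined by its values
on these, as it extends complex linearly to complex-valued test functions. -/
abbrev Test : Type := 𝓓((⊤ : Opens R3), ℝ)

/-- `𝓓'(ℝ³)`: complex-valued distributions on `ℝ³`. -/
abbrev Distr : Type := 𝓓'((⊤ : Opens R3), ℂ)

/-- The `i`-th standard basis vector of `ℝ³`. -/
noncomputable def e (i : Fin 3) : R3 := EuclideanSpace.single i 1

/-- The distributional Laplacian `Δ = ∂₁² + ∂₂² + ∂₃²`. -/
noncomputable def laplacian (u : Distr) : Distr := ∑ i : Fin 3, ∂_{e i} (∂_{e i} u)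

/-- The wave-type operator `P(∂) = (2/3) ∂₃² - (1/3) (∂₁² + ∂₂²)` acting on distributions. -/
noncomputable def waveOp (u : Distr) : Distr :=
  (2 / 3 : ℝ) • ∂_{e 2} (∂_{e 2} u)
    - (1 / 3 : ℝ) • (∂_{e 0} (∂_{e 0} u) + ∂_{e 1} (∂_{e 1} u))

/-- The symbol `p(ξ) = -ξ₃² + |ξ|² / 3` of `P(∂)`. -/
noncomputable def symbol (ξ : R3) : ℝ := -(ξ 2) ^ 2 + (1 / 3) * ‖ξ‖ ^ 2

/-- The characteristic set `Σ = {(x, ξ) : p(ξ) = 0}` in `T*ℝ³ = ℝ³ × ℝ³`. -/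
def charSet : Set (R3 × R3) := {q | symbol q.2 = 0}

/-- `u` is smooth on the set `U`: on test functions supported in `U` it is given by integration
against a function that is smooth on `U`. -/
def IsSmoothOn (u : Distr) (U : Set R3) : Prop :=
  ∃ f : R3 → ℂ, ContDiffOn ℝ ∞ f U ∧
    ∀ φ : Test, tsupport φ ⊆ U → u φ = ∫ x, φ x • f x

/-- The singular support: the points that have no open neighbourhood on which `u` is smooth. -/
def singsupp (u : Distr) : Set R3 :=
  {x | ∀ U : Set R3, IsOpen U → x ∈ U → ¬ IsSmoothOn u U}

/-- The test function `g θ`, for a smooth function `g` and a test function `θ`. -/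
noncomputable def mulTest (g : R3 → ℝ) (hg : ContDiff ℝ ∞ g) (θ : Test) : Test where
  toFun x := g x * θ x
  contDiff' := hg.mul θ.contDiff
  hasCompactSupport' := θ.hasCompactSupport.mul_left
  tsupport_subset' := fun _ _ => trivial

theorem contDiff_cos_inner (ξ : R3) : ContDiff ℝ ∞ fun x : R3 => Real.cos (inner ℝ x ξ) :=
  Real.contDiff_cos.comp (contDiff_id.inner ℝ contDiff_const)

theorem contDiff_sin_inner (ξ : R3) : ContDiff ℝ ∞ fun x : R3 => Real.sin (inner ℝ x ξ) :=
  Real.contDiff_sin.comp (contDiff_id.inner ℝ contDiff_const)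

/-- The Fourier transform of the compactly supported distribution `θ u`,
`(θ u)^(ξ) = u (θ e^{-i x·ξ}) = u (θ cos (x·ξ)) - i u (θ sin (x·ξ))`. -/
noncomputable def localFourier (u : Distr) (θ : Test) (ξ : R3) : ℂ :=
  u (mulTest (fun x => Real.cos (inner ℝ x ξ)) (contDiff_cos_inner ξ) θ)
    - Complex.I * u (mulTest (fun x => Real.sin (inner ℝ x ξ)) (contDiff_sin_inner ξ) θ)

/-- `V` is invariant under multiplication by positive scalars. -/
def IsConic (V : Set R3) : Prop := ∀ ξ ∈ V, ∀ t : ℝ, 0 < t → t • ξ ∈ V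

/-- `u` is microlocally smooth at `(x, ξ)`: after localization by a cut-off that does not vanish
at `x`, its Fourier transform decays rapidly in an open conic neighbourhood of `ξ`. -/
def IsMicroSmoothAt (u : Distr) (x ξ : R3) : Prop :=
  ∃ θ : Test, θ x ≠ 0 ∧ ∃ V : Set R3, IsOpen V ∧ IsConic V ∧ ξ ∈ V ∧
    ∀ N : ℕ, ∃ C : ℝ, ∀ η ∈ V, ‖localFourier u θ η‖ ≤ C / (1 + ‖η‖) ^ N

/-- The wave front set, a subset of `T*ℝ³ ∖ 0`. -/
def WF (u : Distr) : Set (R3 × R3) :=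
  {q | q.2 ≠ 0 ∧ ¬ IsMicroSmoothAt u q.1 q.2}

end QSM

/-!
The solution is constructed on the Fourier side. Choose a test function `θ₀` that is `1` near the
support of `ψ`, and let `Ψ` be the Fourier transform of `θ₀ ψ = ψ`. It is continuous, of polynomial
growth, and `ψ φ = ∫ Ψ 𝓕⁻ φ` for every test function `φ` (`locFT_representation`). Up to the factor
`(2π)²`, the equation `P(∂) χ = -Δ ψ` asks to divide `‖ξ‖² Ψ(ξ)` by the symbol `p(ξ)`.

The wave front condition at all points of the support, together with the compactness of the
support and of the set of characteristic directions, shows that `Ψ` decays rapidly in a conic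
neighbourhood `|p(ξ)| < ε ‖ξ‖²` of the characteristic cone (`exists_rapidOn_near_cone`). Let `κ` be a
function of `p(ξ) / ‖ξ‖²` that cuts off to that neighbourhood and is `1` near the cone, and split
`‖ξ‖² Ψ / p` into two parts (`exists_conic_parametrix`).

* Away from the cone one multiplies `Ψ` by `b = (1 - κ) ‖ξ‖² / p`, which is homogeneous of degree
  zero and smooth off the origin. Such a multiplier does not enlarge the singular support
  (`rapidOn_multiplier`): in the localized Fourier transform `∫ b(η + h) Ψ(η + h) 𝓕⁻ θ(h) dh` the
  Taylor polynomial of `b` at `η` produces Fourier transforms of `ψ` localized by derivatives of `θ`,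
  which decay rapidly if `ψ` is smooth near the support of `θ`, and the remainder is
  `O(‖η‖ ^ (-n))` for every `n`.
* Near the cone, `κ Ψ` decays rapidly, so only the division by `p` has to be given a meaning. The
  functional `φ ↦ ∫ κ(ξ) ‖ξ‖² Ψ(ξ) (𝓕⁻ φ(ξ) - 𝓕⁻ φ(ξ*)) / p(ξ) dξ`, where `ξ*` is the vertical
  projection of `ξ` to the cone, is a distribution with rapidly decaying localized Fourier
  transforms, hence a smooth function (`exists_smooth_division`). Applied to `P(∂) φ`, whose
  transform is a multiple of `p 𝓕⁻ φ`, the subtracted term vanishes and the factor `p` cancels, since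
  `p ≠ 0` almost everywhere.

The sum `χ` of the two parts solves the equation. To pass between smoothness and rapid decay one
uses `isSmoothOn_of_rapidOn` and `IsSmoothOn.rapidOn`. Finally the singular support is closed and
contained in the support, hence compact for `ψ`, and then also for `χ`.
-/

namespace QSM

open SchwartzMap FourierTransform

/-! ### Test functions and Schwartz functions -/

theorem Test.contDiff_ofReal (φ : Test) : ContDiff ℝ ∞ fun x => (φ x : ℂ) :=
  Complex.ofRealCLM.contDiff.comp φ.contDiff

/-- A test function, regarded as a complex-valued Schwartz function. -/
noncomputable def Test.toSchwartz (φ : Test) : 𝓢(R3, ℂ) :=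
  (φ.hasCompactSupport.comp_left (g := Complex.ofReal) Complex.ofReal_zero).toSchwartzMap
    φ.contDiff_ofReal

@[simp]
theorem Test.toSchwartz_apply (φ : Test) (x : R3) : φ.toSchwartz x = φ x := rfl

/-- The inclusion of test functions into Schwartz functions, as a continuous linear map. -/
noncomputable def toSchwartzCLM : Test →L[ℝ] 𝓢(R3, ℂ) :=
  TestFunction.mkCLM ℝ Test.toSchwartz
    (fun f g => by ext x; simp)
    (fun c f => by ext x; simp)
    (fun K hK => by
      let Φ : ContDiffMapSupportedIn R3 ℝ ⊤ K →ₗ[ℝ] 𝓢(R3, ℂ) :=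
        { toFun := fun f => Test.toSchwartz (TestFunction.ofSupportedIn hK f)
          map_add' := fun f g => by ext x; simp
          map_smul' := fun c f => by ext x; simp }
      change Continuous Φ
      refine WithSeminorms.continuous_of_isBounded (ContDiffMapSupportedIn.withSeminorms ℝ R3 ℝ ⊤ K)
        (schwartz_withSeminorms ℝ R3 ℂ) Φ ?_
      intro n
      obtain ⟨R, hR⟩ := K.isCompact.isBounded.exists_norm_le
      refine ⟨{n.2}, (Real.toNNReal R) ^ n.1, fun f => ?_⟩
      simp only [Finset.sup_singleton]
      refine SchwartzMap.seminorm_le_bound ℝ n.1 n.2 _ (by positivity) fun x => ?_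
      have h1 : ‖iteratedFDeriv ℝ n.2 (Φ f) x‖ = ‖iteratedFDeriv ℝ n.2 f x‖ := by
        have := Complex.ofRealLI.norm_iteratedFDeriv_comp_left (f := f) (x := x)
          (f.contDiff.contDiffAt) (i := n.2) (by exact_mod_cast le_top)
        exact this
      rw [h1]
      by_cases hx : x ∈ K
      · have h2 := ContDiffMapSupportedIn.norm_iteratedFDeriv_apply_le_seminorm_top ℝ
          (i := n.2) (f := f) (x := x)
        have h3 : ‖x‖ ≤ Real.toNNReal R := (hR x hx).trans (Real.le_coe_toNNReal R)
        simp only [smul_apply, NNReal.smul_def, NNReal.coe_pow, smul_eq_mul]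
        gcongr
      · have : iteratedFDeriv ℝ n.2 f x = 0 := f.iteratedFDeriv_zero_on_compl hx
        rw [this]; simp only [norm_zero, mul_zero]; exact apply_nonneg _ _)

@[simp]
theorem toSchwartzCLM_apply (φ : Test) : toSchwartzCLM φ = φ.toSchwartz := rfl

/-- The distribution `φ ↦ A φ` given by a functional `A` on Schwartz functions. -/
noncomputable def ofSchwartz (A : 𝓢(R3, ℂ) →L[ℂ] ℂ) : Distr :=
  ((A.restrictScalars ℝ).comp toSchwartzCLM : Test →L[ℝ] ℂ)

@[simp]
theorem ofSchwartz_apply (A : 𝓢(R3, ℂ) →L[ℂ] ℂ) (φ : Test) :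
    ofSchwartz A φ = A φ.toSchwartz := rfl

/-- The Schwartz function `x ↦ e^{-2πi x·η} θ(x)`. -/
noncomputable def modulate (θ : Test) (η : R3) : 𝓢(R3, ℂ) :=
  (mulTest _ (contDiff_cos_inner ((2 * Real.pi) • η)) θ).toSchwartz
    - Complex.I • (mulTest _ (contDiff_sin_inner ((2 * Real.pi) • η)) θ).toSchwartz

@[simp]
theorem mulTest_apply (g : R3 → ℝ) (hg : ContDiff ℝ ∞ g) (θ : Test) (x : R3) :
    mulTest g hg θ x = g x * θ x := rfl

theorem modulate_apply (θ : Test) (η x : R3) :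
    modulate θ η x = Complex.exp (-(2 * Real.pi * inner ℝ x η : ℝ) * Complex.I) * θ x := by
  simp only [modulate, sub_apply, smul_apply, Test.toSchwartz_apply,
    mulTest_apply, inner_smul_right, smul_eq_mul]
  rw [Complex.exp_mul_I, Complex.cos_neg, Complex.sin_neg]
  push_cast
  ring

/-- Modulation translates the inverse Fourier transform. -/
theorem fourierInv_modulate (θ : Test) (η ξ : R3) :
    𝓕⁻ (modulate θ η) ξ = 𝓕⁻ θ.toSchwartz (ξ - η) := by
  simp only [SchwartzMap.fourierInv_coe, Real.fourierInv_eq']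
  refine integral_congr_ae (Filter.Eventually.of_forall fun x => ?_)
  simp only [modulate_apply, smul_eq_mul, Test.toSchwartz_apply]
  rw [← mul_assoc, ← Complex.exp_add, inner_sub_right]
  congr 2
  push_cast
  ring

/-- The Fourier transform of `θ u` in the normalization `ξ ↦ u (θ e^{-2πi x·ξ})`, which is the one
of `𝓕` and differs from that of `localFourier` by a dilation. -/
noncomputable def locFT (u : Distr) (θ : Test) (ξ : R3) : ℂ :=
  localFourier u θ ((2 * Real.pi) • ξ)

theorem locFT_ofSchwartz (A : 𝓢(R3, ℂ) →L[ℂ] ℂ) (θ : Test) (η : R3) :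
    locFT (ofSchwartz A) θ η = A (modulate θ η) := by
  simp [locFT, localFourier, modulate]

/-- The product of a test function with the real part of a Schwartz function. -/
noncomputable def reMul (θ : Test) (S : 𝓢(R3, ℂ)) : Test :=
  mulTest (fun x => (S x).re) (Complex.reCLM.contDiff.comp (S.smooth ⊤)) θ

/-- The product of a test function with the imaginary part of a Schwartz function. -/
noncomputable def imMul (θ : Test) (S : 𝓢(R3, ℂ)) : Test :=
  mulTest (fun x => (S x).im) (Complex.imCLM.contDiff.comp (S.smooth ⊤)) θ

@[simp]
theorem reMul_apply (θ : Test) (S : 𝓢(R3, ℂ)) (x : R3) : reMul θ S x = (S x).re * θ x := rfl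

@[simp]
theorem imMul_apply (θ : Test) (S : 𝓢(R3, ℂ)) (x : R3) : imMul θ S x = (S x).im * θ x := rfl

/-- The compactly supported distribution `θ u`, extended complex linearly to Schwartz functions. -/
noncomputable def cutFun (u : Distr) (θ : Test) : 𝓢(R3, ℂ) →ₗ[ℂ] ℂ where
  toFun S := u (reMul θ S) + Complex.I * u (imMul θ S)
  map_add' S T := by
    have h1 : reMul θ (S + T) = reMul θ S + reMul θ T := by ext x; simp [add_mul]
    have h2 : imMul θ (S + T) = imMul θ S + imMul θ T := by ext x; simp [add_mul]
    rw [h1, h2, map_add, map_add]; ring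
  map_smul' c S := by
    have h1 : reMul θ (c • S) = c.re • reMul θ S - c.im • imMul θ S := by
      ext x; simp [sub_mul, mul_assoc]
    have h2 : imMul θ (c • S) = c.re • imMul θ S + c.im • reMul θ S := by
      ext x; simp [add_mul, mul_assoc]
    rw [h1, h2, map_add, map_sub, map_smul, map_smul, map_smul, map_smul]
    simp only [Complex.real_smul, smul_eq_mul, RingHom.id_apply]
    conv_rhs => rw [← Complex.re_add_im c]
    linear_combination (-(c.im : ℂ) * u (imMul θ S)) * Complex.I_mul_I

theorem cutFun_apply (u : Distr) (θ : Test) (S : 𝓢(R3, ℂ)) :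
    cutFun u θ S = u (reMul θ S) + Complex.I * u (imMul θ S) := rfl

/-- The product of two test functions. -/
noncomputable def prodTest (θ φ : Test) : Test := mulTest θ θ.contDiff φ

@[simp]
theorem prodTest_apply (θ φ : Test) (x : R3) : prodTest θ φ x = θ x * φ x := rfl

theorem cutFun_toSchwartz (u : Distr) (θ φ : Test) :
    cutFun u θ φ.toSchwartz = u (prodTest θ φ) := by
  have h1 : reMul θ φ.toSchwartz = prodTest θ φ := by ext x; simp [mul_comm]
  have h2 : imMul θ φ.toSchwartz = 0 := by ext x; simp
  rw [cutFun_apply, h1, h2, map_zero, mul_zero, add_zero]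

/-- Modulations play the role of exponentials: `θ u` applied to `φ e^{-2πi x·η}` is the Fourier
transform of `θ φ u` at `η`. -/
theorem cutFun_modulate (u : Distr) (θ φ : Test) (η : R3) :
    cutFun u θ (modulate φ η) = locFT u (prodTest θ φ) η := by
  rw [modulate, map_sub, map_smul, cutFun_toSchwartz, cutFun_toSchwartz, locFT, localFourier,
    smul_eq_mul]
  congr 3
  · ext x; simp; ring
  · ext x; simp; ring

theorem cutFun_congr (u : Distr) (θ : Test) {S T : 𝓢(R3, ℂ)}
    (h : ∀ x, θ x ≠ 0 → S x = T x) : cutFun u θ S = cutFun u θ T := by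
  have key : ∀ x, (S x).re * θ x = (T x).re * θ x ∧ (S x).im * θ x = (T x).im * θ x := by
    intro x
    by_cases hx : θ x = 0
    · simp [hx]
    · simp [h x hx]
  have h1 : reMul θ S = reMul θ T := by ext x; simpa using (key x).1
  have h2 : imMul θ S = imMul θ T := by ext x; simpa using (key x).2
  rw [cutFun_apply, cutFun_apply, h1, h2]

/-- A distribution has finite order on each compact set. -/
theorem exists_bound_of_tsupport_subset (u : Distr) (K : Compacts R3) :
    ∃ (m : ℕ) (C : ℝ), 0 ≤ C ∧ ∀ (φ : Test) (B : ℝ), tsupport φ ⊆ K → 0 ≤ B →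
      (∀ j ≤ m, ∀ x, ‖iteratedFDeriv ℝ j φ x‖ ≤ B) → ‖u φ‖ ≤ C * B := by
  have hK : (K : Set R3) ⊆ ((⊤ : Opens R3) : Set R3) := fun _ _ => trivial
  let v : ContDiffMapSupportedIn R3 ℝ ⊤ K →ₗ[ℝ] ℂ :=
    { toFun := fun f => u (TestFunction.ofSupportedIn hK f)
      map_add' := fun f g => by rw [← map_add]; rfl
      map_smul' := fun c f => by rw [RingHom.id_apply, ← map_smul]; rfl }
  have hv : Continuous v :=
    (map_continuous u).comp (TestFunction.continuous_ofSupportedIn hK)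
  obtain ⟨s, C, -, hC⟩ := Seminorm.bound_of_continuous
    (ContDiffMapSupportedIn.withSeminorms ℝ R3 ℝ ⊤ K)
    ((normSeminorm ℝ ℂ).comp v) (continuous_norm.comp hv)
  refine ⟨s.sup id, C, C.2, fun φ B hφ hB hb => ?_⟩
  let f : ContDiffMapSupportedIn R3 ℝ ⊤ K :=
    .of_support_subset φ.contDiff ((subset_tsupport φ).trans hφ)
  have h1 : u φ = v f := by
    change u φ = u (TestFunction.ofSupportedIn hK f)
    congr 1
  have h2 := hC f
  rw [h1]
  refine h2.trans ?_
  simp only [smul_apply, NNReal.smul_def, smul_eq_mul]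
  refine mul_le_mul_of_nonneg_left ?_ C.2
  refine Seminorm.finset_sup_apply_le hB fun i hi => ?_
  rw [ContDiffMapSupportedIn.seminorm_top_le_iff ℝ hB]
  intro x _
  exact hb i (Finset.le_sup (f := id) hi) x

theorem Test.exists_iteratedFDeriv_bound (θ : Test) (j : ℕ) :
    ∃ C, ∀ x, ‖iteratedFDeriv ℝ j θ x‖ ≤ C :=
  ((θ.contDiff.of_le (by exact_mod_cast le_top) : ContDiff ℝ j θ).continuous_iteratedFDeriv'
    ).bounded_above_of_compact_support (θ.hasCompactSupport.iteratedFDeriv j)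

/-- The functional `θ u` is bounded by finitely many sup norms of derivatives, without weights. -/
theorem exists_cutFun_bound (u : Distr) (θ : Test) :
    ∃ (m : ℕ) (C : ℝ), 0 ≤ C ∧ ∀ (S : 𝓢(R3, ℂ)) (B : ℝ), 0 ≤ B →
      (∀ j ≤ m, ∀ x, ‖iteratedFDeriv ℝ j S x‖ ≤ B) → ‖cutFun u θ S‖ ≤ C * B := by
  obtain ⟨m, C, hC, h⟩ := exists_bound_of_tsupport_subset u ⟨tsupport θ, θ.hasCompactSupport⟩
  choose D hD using θ.exists_iteratedFDeriv_bound
  have hD0 : ∀ j, 0 ≤ D j := fun j => (norm_nonneg _).trans (hD j 0)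
  set E : ℝ := ∑ n ∈ Finset.range (m + 1), ∑ i ∈ Finset.range (n + 1), (n.choose i : ℝ) * D (n - i)
    with hE
  have hE0 : 0 ≤ E := Finset.sum_nonneg fun n _ => Finset.sum_nonneg fun i _ =>
    mul_nonneg (by positivity) (hD0 _)
  have main : ∀ (g : R3 → ℝ) (hg : ContDiff ℝ ∞ g) (B : ℝ), 0 ≤ B →
      (∀ j ≤ m, ∀ x, ‖iteratedFDeriv ℝ j g x‖ ≤ B) → ‖u (mulTest g hg θ)‖ ≤ C * (E * B) := by
    intro g hg B hB hb
    refine h _ _ (closure_mono (Function.support_mul_subset_right g θ)) (by positivity)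
      fun j hj x => ?_
    refine (norm_iteratedFDeriv_mul_le hg θ.contDiff x (by exact_mod_cast le_top)).trans ?_
    rw [hE, Finset.sum_mul]
    refine le_trans ?_ (Finset.single_le_sum (f := fun n =>
      (∑ i ∈ Finset.range (n + 1), (n.choose i : ℝ) * D (n - i)) * B) (fun n _ => mul_nonneg
      (Finset.sum_nonneg fun i _ => mul_nonneg (by positivity) (hD0 _)) hB)
      (Finset.mem_range.2 (Nat.lt_succ_of_le hj)))
    rw [Finset.sum_mul]
    refine Finset.sum_le_sum fun i hi => ?_
    have h1 := hb i ((Nat.lt_succ_iff.1 (Finset.mem_range.1 hi)).trans hj) x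
    have h2 := hD (j - i) x
    calc _ ≤ (j.choose i : ℝ) * B * D (j - i) := by gcongr
      _ = _ := by ring
  refine ⟨m, 2 * (C * E), by positivity, fun S B hB hb => ?_⟩
  have hre : ‖u (reMul θ S)‖ ≤ C * (E * B) := main _ _ B hB fun j hj x => by
    have := Complex.reCLM.norm_iteratedFDeriv_comp_left (f := S) (x := x) (n := j)
      (S.contDiffAt ⊤) (by exact_mod_cast le_top)
    simp only [Complex.reCLM_norm, one_mul] at this
    exact this.trans (hb j hj x)
  have him : ‖u (imMul θ S)‖ ≤ C * (E * B) := main _ _ B hB fun j hj x => by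
    have := Complex.imCLM.norm_iteratedFDeriv_comp_left (f := S) (x := x) (n := j)
      (S.contDiffAt ⊤) (by exact_mod_cast le_top)
    simp only [Complex.imCLM_norm, one_mul] at this
    exact this.trans (hb j hj x)
  rw [cutFun_apply]
  refine (norm_add_le _ _).trans ?_
  rw [norm_mul, Complex.norm_I, one_mul]
  linarith

/-! ### Weights -/

theorem one_le_weight (x : R3) : 1 ≤ 1 + ‖x‖ := by linarith [norm_nonneg x]

/-- Peetre's inequality. -/
theorem weight_add_le (a b : R3) : 1 + ‖a + b‖ ≤ (1 + ‖a‖) * (1 + ‖b‖) := by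
  nlinarith [norm_add_le a b, norm_nonneg a, norm_nonneg b, mul_nonneg (norm_nonneg a) (norm_nonneg b)]

theorem exists_schwartz_decay (g : 𝓢(R3, ℂ)) (K : ℕ) :
    ∃ C, 0 ≤ C ∧ ∀ x, ‖g x‖ ≤ C / (1 + ‖x‖) ^ K := by
  refine ⟨2 ^ K * (Finset.Iic (K, 0)).sup (fun m => SchwartzMap.seminorm ℂ m.1 m.2) g,
    mul_nonneg (by positivity) (apply_nonneg _ _), fun x => ?_⟩
  have := one_add_le_sup_seminorm_apply (𝕜 := ℂ) (m := (K, 0)) le_rfl le_rfl g x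
  rw [norm_iteratedFDeriv_zero] at this
  rw [le_div_iff₀ (by have := one_le_weight x; positivity), mul_comm]
  exact this

theorem integrable_weight_mul (g : 𝓢(R3, ℂ)) (K : ℕ) :
    Integrable fun x => (1 + ‖x‖) ^ K * ‖g x‖ := by
  simp_rw [add_pow, one_pow, one_mul, Finset.sum_mul]
  refine integrable_finsetSum _ fun i _ => ?_
  have := (g.integrable_pow_mul volume (K - i)).const_mul (K.choose i : ℝ)
  refine this.congr (Filter.Eventually.of_forall fun x => ?_)
  simp only; ring

theorem memLp_weight_inv_sq : MemLp (fun x : R3 => ((1 + ‖x‖) ^ 2)⁻¹) 2 volume := by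
  have hm : Continuous fun x : R3 => ((1 + ‖x‖) ^ 2)⁻¹ := by
    refine Continuous.inv₀ (by fun_prop) fun x => ?_
    have := one_le_weight x; positivity
  rw [memLp_two_iff_integrable_sq hm.aestronglyMeasurable]
  have h : Integrable fun x : R3 => (1 + ‖x‖) ^ (-(4 : ℝ)) :=
    integrable_one_add_norm (by simp; norm_num)
  refine h.congr (Filter.Eventually.of_forall fun x => ?_)
  have := one_le_weight x
  simp only
  rw [Real.rpow_neg (by positivity), inv_pow, ← pow_mul]
  norm_cast

theorem weight_sq_le (x : R3) : (1 + ‖x‖) ^ 2 ≤ 2 * (1 + ‖x‖ ^ 2) := by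
  nlinarith [sq_nonneg (1 - ‖x‖)]

/-! ### Fourier representation of compactly supported distributions -/

/-- By the Cauchy-Schwarz inequality, the `L²` norm controls the `L¹` norm with weight
`(1 + ‖x‖) ^ (-2)`, which is square integrable in dimension three. -/
theorem exists_integral_mul_norm_le :
    ∃ C, 0 ≤ C ∧ ∀ h : 𝓢(R3, ℂ), ∫ x, ((1 + ‖x‖) ^ 2)⁻¹ * ‖h x‖ ≤ C * ‖toLpCLM ℂ ℂ 2 volume h‖ := by
  refine ⟨(∫ x : R3, (((1 + ‖x‖) ^ 2)⁻¹) ^ (2 : ℝ)) ^ (1 / (2 : ℝ)), by positivity, fun h => ?_⟩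
  have h2 : MemLp (fun x => ‖h x‖) 2 volume := (h.memLp 2 volume).norm
  have := integral_mul_le_Lp_mul_Lq_of_nonneg (μ := (volume : Measure R3))
    (Real.HolderConjugate.two_two) (f := fun x => ((1 + ‖x‖) ^ 2)⁻¹) (g := fun x => ‖h x‖)
    (Filter.Eventually.of_forall fun x => by positivity)
    (Filter.Eventually.of_forall fun x => by positivity)
    (by simpa using memLp_weight_inv_sq) (by simpa using h2)
  refine this.trans (le_of_eq ?_)
  rw [toLpCLM_apply, norm_toLp' (by norm_num) (by norm_num)]
  simp

/-- A functional on Schwartz functions that is bounded in the `L²` norm has an `L²` density. -/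
theorem exists_L2_density (Λ : 𝓢(R3, ℂ) →ₗ[ℂ] ℂ) (C : ℝ)
    (hΛ : ∀ h, ‖Λ h‖ ≤ C * ‖toLpCLM ℂ ℂ 2 (volume : Measure R3) h‖) :
    ∃ G : Lp ℂ 2 (volume : Measure R3), ∀ h : 𝓢(R3, ℂ), Λ h = ∫ ξ, (starRingEnd ℂ) (G ξ) * h ξ := by
  have hdense : DenseRange (toLpCLM ℂ ℂ 2 (volume : Measure R3)).toLinearMap :=
    denseRange_toLpCLM (E := R3) (F := ℂ) (p := 2) (by norm_num)
  set ext := Λ.extendOfNorm (toLpCLM ℂ ℂ 2 (volume : Measure R3)).toLinearMap with hext_def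
  have hext : ∀ h, ext (toLpCLM ℂ ℂ 2 volume h) = Λ h :=
    LinearMap.extendOfNorm_eq hdense ⟨_, hΛ⟩
  refine ⟨(InnerProductSpace.toDual ℂ _).symm ext, fun h => ?_⟩
  rw [← hext, ← InnerProductSpace.toDual_symm_apply (𝕜 := ℂ) (y := ext), L2.inner_def]
  refine integral_congr_ae ?_
  filter_upwards [h.coeFn_toLp 2 volume] with x hx
  rw [toLpCLM_apply, hx, RCLike.inner_apply, mul_comm]

/-- A functional `T` for which `T (𝓕 g)` is bounded by a weighted `L¹` norm of `g` is given by a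
locally integrable density on the Fourier side. After multiplication of `g` by a large negative power
of `1 + ‖ξ‖ ^ 2` the bound is one by the `L²` norm, so that `exists_L2_density` applies. -/
theorem exists_density (T : 𝓢(R3, ℂ) →ₗ[ℂ] ℂ) (m : ℕ) (C : ℝ) (hC : 0 ≤ C)
    (hT : ∀ g : 𝓢(R3, ℂ), ‖T (𝓕 g)‖ ≤ C * ∫ ξ, (1 + ‖ξ‖) ^ m * ‖g ξ‖) :
    ∃ (F : R3 → ℂ) (K : ℕ), AEStronglyMeasurable F volume ∧
      Integrable (fun ξ => ‖F ξ‖ / (1 + ‖ξ‖) ^ K) ∧ ∀ S, T S = ∫ ξ, F ξ * 𝓕⁻ S ξ := by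
  set k : ℕ := m + 2 with hk
  let w : R3 → ℝ := fun ξ => (1 + ‖ξ‖ ^ 2) ^ (-(k : ℝ))
  let w' : R3 → ℝ := fun ξ => (1 + ‖ξ‖ ^ 2) ^ (k : ℝ)
  have hw : w.HasTemperateGrowth := Function.hasTemperateGrowth_one_add_norm_sq_rpow _ _
  have hw' : w'.HasTemperateGrowth := Function.hasTemperateGrowth_one_add_norm_sq_rpow _ _
  have hww : ∀ ξ, w ξ * w' ξ = 1 := fun ξ => by
    have : (0 : ℝ) < 1 + ‖ξ‖ ^ 2 := by positivity
    simp only [w, w']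
    rw [← Real.rpow_add this]; simp
  have hw'e : ∀ ξ, w' ξ = (1 + ‖ξ‖ ^ 2) ^ k := fun ξ => Real.rpow_natCast _ _
  let Λ : 𝓢(R3, ℂ) →ₗ[ℂ] ℂ := T ∘ₗ (fourierCLM ℂ 𝓢(R3, ℂ) ∘L
    smulLeftCLM ℂ (fun ξ => (w ξ : ℂ))).toLinearMap
  have hwc : (fun ξ => (w ξ : ℂ)).HasTemperateGrowth := by fun_prop
  have hwc' : (fun ξ => (w' ξ : ℂ)).HasTemperateGrowth := by fun_prop
  have hΛ : ∀ h, Λ h = T (𝓕 (smulLeftCLM ℂ (fun ξ => (w ξ : ℂ)) h)) := fun h => rfl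
  obtain ⟨D, hD0, hD⟩ := exists_integral_mul_norm_le
  have hΛb : ∀ h, ‖Λ h‖ ≤ (C * (2 ^ k * D)) * ‖toLpCLM ℂ ℂ 2 volume h‖ := by
    intro h
    rw [hΛ]
    refine (hT _).trans ?_
    rw [mul_assoc]
    refine mul_le_mul_of_nonneg_left ?_ hC
    refine le_trans ?_ ((mul_le_mul_of_nonneg_left (hD h) (by positivity : (0 : ℝ) ≤ 2 ^ k)).trans_eq
      (mul_assoc _ _ _).symm)
    rw [← integral_const_mul]
    refine integral_mono_of_nonneg (Filter.Eventually.of_forall fun x => by positivity) ?_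
      (Filter.Eventually.of_forall fun x => ?_)
    · refine Integrable.const_mul ?_ _
      exact MemLp.integrable_mul memLp_weight_inv_sq (h.memLp 2 volume).norm
    · simp only
      rw [smulLeftCLM_apply_apply hwc, smul_eq_mul, norm_mul, ← mul_assoc, ← mul_assoc]
      refine mul_le_mul_of_nonneg_right ?_ (norm_nonneg _)
      have h1 := one_le_weight x
      have h2 : (1 + ‖x‖) ^ (m + 2) ≤ 2 ^ k * w' x := by
        rw [hw'e, ← mul_pow]
        calc (1 + ‖x‖) ^ (m + 2) ≤ ((1 + ‖x‖) ^ 2) ^ k := by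
              rw [← pow_mul]; exact pow_le_pow_right₀ h1 (by omega)
          _ ≤ _ := by gcongr; exact weight_sq_le x
      have h3 : 0 < w x := by simp only [w]; positivity
      rw [Complex.norm_real, Real.norm_of_nonneg h3.le, ← div_eq_mul_inv, le_div_iff₀ (by positivity)]
      calc (1 + ‖x‖) ^ m * w x * (1 + ‖x‖) ^ 2 = (1 + ‖x‖) ^ (m + 2) * w x := by ring
        _ ≤ 2 ^ k * w' x * w x := by gcongr
        _ = 2 ^ k := by rw [mul_assoc, mul_comm (w' x), hww, mul_one]
  obtain ⟨G, hG⟩ := exists_L2_density Λ _ hΛb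
  refine ⟨fun ξ => (starRingEnd ℂ) (G ξ) * w' ξ, 2 * k + 2, ?_, ?_, fun S => ?_⟩
  · refine AEStronglyMeasurable.mul ?_ hwc'.1.continuous.aestronglyMeasurable
    exact Complex.continuous_conj.comp_aestronglyMeasurable (Lp.aestronglyMeasurable G)
  · have hi : Integrable fun ξ => ‖G ξ‖ * ((1 + ‖ξ‖) ^ 2)⁻¹ :=
      MemLp.integrable_mul (Lp.memLp G).norm memLp_weight_inv_sq
    refine hi.mono' ?_ (Filter.Eventually.of_forall fun x => ?_)
    · refine AEStronglyMeasurable.mul ?_ (Continuous.aestronglyMeasurable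
        (Continuous.inv₀ (by fun_prop) fun x => by have := one_le_weight x; positivity))
      refine (AEStronglyMeasurable.mul ?_ hwc'.1.continuous.aestronglyMeasurable).norm
      exact Complex.continuous_conj.comp_aestronglyMeasurable (Lp.aestronglyMeasurable G)
    · have h1 := one_le_weight x
      rw [norm_div, norm_norm, norm_mul, RCLike.norm_conj, Complex.norm_real, hw'e,
        Real.norm_of_nonneg (by positivity), Real.norm_of_nonneg (by positivity), mul_div_assoc]
      gcongr
      have h2 : ((1 + ‖x‖) ^ 2)⁻¹ * (1 + ‖x‖) ^ (2 * k + 2) = ((1 + ‖x‖) ^ 2) ^ k := by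
        rw [← pow_mul, pow_add, mul_comm, mul_assoc, mul_inv_cancel₀ (by positivity), mul_one]
      rw [div_le_iff₀ (by positivity), h2]
      gcongr
      nlinarith [norm_nonneg x]
  · have h1 : S = 𝓕 (smulLeftCLM ℂ (fun ξ => (w ξ : ℂ))
        (smulLeftCLM ℂ (fun ξ => (w' ξ : ℂ)) (𝓕⁻ S))) := by
      have : smulLeftCLM ℂ (fun ξ => (w ξ : ℂ))
        (smulLeftCLM ℂ (fun ξ => (w' ξ : ℂ)) (𝓕⁻ S)) = 𝓕⁻ S := by
        ext x
        rw [smulLeftCLM_apply_apply hwc, smulLeftCLM_apply_apply hwc', smul_smul,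
          ← Complex.ofReal_mul, hww]
        simp
      rw [this, fourier_fourierInv_eq]
    conv_lhs => rw [h1]
    rw [← hΛ, hG]
    refine integral_congr_ae (Filter.Eventually.of_forall fun x => ?_)
    simp only
    rw [smulLeftCLM_apply_apply hwc', smul_eq_mul, mul_assoc]

/-- The order bound for `θ u`, on the Fourier side: derivatives of `𝓕 g` are controlled by the
moments of `g`. -/
theorem exists_cutFun_fourier_bound (u : Distr) (θ : Test) :
    ∃ (m : ℕ) (C : ℝ), 0 ≤ C ∧ ∀ g : 𝓢(R3, ℂ),
      ‖cutFun u θ (𝓕 g)‖ ≤ C * ∫ ξ, (1 + ‖ξ‖) ^ m * ‖g ξ‖ := by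
  obtain ⟨m, C, hC, h⟩ := exists_cutFun_bound u θ
  refine ⟨m, C * ((2 * Real.pi) ^ m * (m + 1)), by positivity, fun g => ?_⟩
  rw [mul_assoc]
  set I := ∫ ξ, (1 + ‖ξ‖) ^ m * ‖g ξ‖ with hI
  have hI0 : 0 ≤ I := integral_nonneg fun x => by positivity
  refine h _ _ (by positivity) fun j hj x => ?_
  have h1 := Real.pow_mul_norm_iteratedFDeriv_fourier_le (f := g) (K := ⊤) (N := ⊤)
    (g.smooth ⊤) (fun k n _ _ => g.integrable_pow_mul_iteratedFDeriv volume k n)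
    (k := j) (n := 0) le_top le_top x
  simp only [pow_zero, one_mul, mul_one, zero_add, Finset.range_one] at h1
  rw [SchwartzMap.fourier_coe]
  refine h1.trans ?_
  have hpi : (1 : ℝ) ≤ 2 * Real.pi := by linarith [Real.pi_gt_three]
  have h2 : ∀ p ∈ Finset.range (j + 1) ×ˢ ({0} : Finset ℕ),
      ∫ v, ‖v‖ ^ p.1 * ‖iteratedFDeriv ℝ p.2 g v‖ ≤ I := by
    intro p hp
    simp only [Finset.mem_product, Finset.mem_range, Finset.mem_singleton] at hp
    rw [hp.2]
    refine integral_mono_of_nonneg (Filter.Eventually.of_forall fun x => by positivity)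
      (integrable_weight_mul g m) (Filter.Eventually.of_forall fun x => ?_)
    simp only [norm_iteratedFDeriv_zero]
    gcongr
    have := one_le_weight x
    calc ‖x‖ ^ p.1 ≤ (1 + ‖x‖) ^ p.1 := by gcongr; linarith
      _ ≤ _ := pow_le_pow_right₀ this (by omega)
  refine (mul_le_mul_of_nonneg_left (Finset.sum_le_card_nsmul _ _ _ h2) (by positivity)).trans ?_
  rw [Finset.card_product, Finset.card_range, Finset.card_singleton, mul_one, nsmul_eq_mul]
  rw [mul_assoc]
  have h3 : (2 * Real.pi) ^ j ≤ (2 * Real.pi) ^ m := pow_le_pow_right₀ hpi hj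
  push_cast
  have h4 : (j : ℝ) ≤ m := by exact_mod_cast hj
  gcongr

/-- There is a test function equal to `1` near a given compact set, supported in a given
neighbourhood of it. -/
theorem exists_test_eq_one {K U : Set R3} (hK : IsCompact K) (hU : IsOpen U) (hKU : K ⊆ U) :
    ∃ θ : Test, tsupport θ ⊆ U ∧ (∀ x, 0 ≤ θ x) ∧ ∃ W, IsOpen W ∧ K ⊆ W ∧ ∀ x ∈ W, θ x = 1 := by
  obtain ⟨L, hL, hKL, hLU⟩ := exists_compact_between hK hU hKU
  obtain ⟨f, hf1, hf0, hf01⟩ := exists_contMDiffMap_one_nhds_of_subset_interior (n := ⊤)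
    (modelWithCornersSelf ℝ R3) hK.isClosed hKL
  have hts : tsupport f ⊆ L := closure_minimal
    (fun x hx => by by_contra h; exact hx (hf0 x h)) hL.isClosed
  refine ⟨⟨f, f.contMDiff.contDiff, hL.of_isClosed_subset (isClosed_tsupport f) hts,
    fun _ _ => trivial⟩, hts.trans hLU, fun x => (hf01 x).1, ?_⟩
  obtain ⟨W, hW, hKW, hW1⟩ := mem_nhdsSet_iff_exists.1 hf1
  exact ⟨W, hW, hKW, hW1⟩

theorem inv_weight_sub_le (a b : R3) (K : ℕ) :
    1 / (1 + ‖a - b‖) ^ K ≤ (1 + ‖b‖) ^ K / (1 + ‖a‖) ^ K := by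
  have h1 := one_le_weight a
  have h2 := one_le_weight (a - b)
  rw [div_le_div_iff₀ (by positivity) (by positivity), one_mul, ← mul_pow]
  gcongr
  have := weight_add_le b (a - b)
  rwa [add_sub_cancel] at this

/-- The function `locFT u θ` is continuous and of polynomial growth, and it represents `θ u` on the
Fourier side. The density `F` of `exists_density` is only known to be locally integrable with
polynomial weights; since `θ φ = θ` for a suitable cut-off `φ`, it may be replaced by its correlation
with `𝓕⁻ φ`, and this is `locFT u θ`. -/
theorem locFT_representation (u : Distr) (θ : Test) :
    Continuous (locFT u θ) ∧
    (∃ (M : ℕ) (C : ℝ), 0 ≤ C ∧ ∀ ξ, ‖locFT u θ ξ‖ ≤ C * (1 + ‖ξ‖) ^ M) ∧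
    ∀ S : 𝓢(R3, ℂ), cutFun u θ S = ∫ ξ, locFT u θ ξ * 𝓕⁻ S ξ := by
  obtain ⟨m, C, hC, hT⟩ := exists_cutFun_fourier_bound u θ
  obtain ⟨F, K, hFm, hFi, hF⟩ := exists_density (cutFun u θ) m C hC hT
  obtain ⟨φ, -, -, W, -, hKW, hW⟩ := exists_test_eq_one (K := tsupport θ) θ.hasCompactSupport
    isOpen_univ (Set.subset_univ _)
  have hφ : ∀ x, θ x ≠ 0 → φ x = 1 := fun x hx => hW x (hKW (subset_tsupport _ hx))
  have hprod : prodTest θ φ = θ := by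
    ext x
    by_cases hx : θ x = 0
    · simp [hx]
    · simp [hφ x hx]
  set g' := 𝓕⁻ φ.toSchwartz with hg'
  obtain ⟨D, hD0, hD⟩ := exists_schwartz_decay g' K
  have hrep : ∀ ξ, locFT u θ ξ = ∫ ζ, F ζ * g' (ζ - ξ) := fun ξ => by
    conv_lhs => rw [← hprod, ← cutFun_modulate, hF]
    simp_rw [fourierInv_modulate]
    rfl
  have hbd : ∀ ζ ξ, ‖F ζ * g' (ζ - ξ)‖ ≤ D * (1 + ‖ξ‖) ^ K * (‖F ζ‖ / (1 + ‖ζ‖) ^ K) := by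
    intro ζ ξ
    have h1 := one_le_weight ζ
    have h2 : ‖g' (ζ - ξ)‖ ≤ D * ((1 + ‖ξ‖) ^ K / (1 + ‖ζ‖) ^ K) := by
      refine (hD _).trans ?_
      rw [div_eq_mul_one_div]
      exact mul_le_mul_of_nonneg_left (inv_weight_sub_le ζ ξ K) hD0
    rw [norm_mul]
    calc _ ≤ ‖F ζ‖ * (D * ((1 + ‖ξ‖) ^ K / (1 + ‖ζ‖) ^ K)) := by gcongr
      _ = _ := by ring
  have hmeas : ∀ ξ, AEStronglyMeasurable (fun ζ => F ζ * g' (ζ - ξ)) volume := fun ξ =>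
    hFm.mul (g'.continuous.comp (continuous_sub_right ξ)).aestronglyMeasurable
  refine ⟨?_, ⟨K, D * ∫ ζ, ‖F ζ‖ / (1 + ‖ζ‖) ^ K, ?_, fun ξ => ?_⟩, fun S => ?_⟩
  · rw [funext hrep, continuous_iff_continuousAt]
    intro ξ₀
    refine continuousAt_of_dominated (bound := fun ζ =>
      D * (2 + ‖ξ₀‖) ^ K * (‖F ζ‖ / (1 + ‖ζ‖) ^ K)) (Filter.Eventually.of_forall hmeas) ?_
      (hFi.const_mul _) (Filter.Eventually.of_forall fun ζ => ?_)
    · filter_upwards [Metric.ball_mem_nhds ξ₀ one_pos] with ξ hξ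
      refine Filter.Eventually.of_forall fun ζ => (hbd ζ ξ).trans ?_
      have h1 := one_le_weight ζ
      have h2 : 1 + ‖ξ‖ ≤ 2 + ‖ξ₀‖ := by
        have := norm_sub_norm_le ξ ξ₀
        rw [mem_ball_iff_norm] at hξ
        linarith
      gcongr
    · exact (continuous_const.mul (g'.continuous.comp (continuous_const.sub continuous_id))
        ).continuousAt
  · exact mul_nonneg hD0 (integral_nonneg fun ζ => by positivity)
  · rw [hrep]
    refine (norm_integral_le_of_norm_le (hFi.const_mul _)
      (Filter.Eventually.of_forall fun ζ => hbd ζ ξ)).trans (le_of_eq ?_)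
    rw [integral_const_mul]; ring
  -- Replacing `S` by `φ S` does not change `θ u`, and convolves `𝓕⁻ S` with `𝓕⁻ φ`.
  · set g := 𝓕⁻ S with hg
    have h1 : cutFun u θ S = cutFun u θ (𝓕 (convolution (ContinuousLinearMap.mul ℂ ℂ) g g')) := by
      refine cutFun_congr u θ fun x hx => ?_
      rw [fourier_convolution, hg, hg', fourier_fourierInv_eq, fourier_fourierInv_eq]
      simp [hφ x hx]
    have h2 : ∀ ζ, convolution (ContinuousLinearMap.mul ℂ ℂ) g g' ζ = ∫ ξ, g ξ * g' (ζ - ξ) :=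
      fun ζ => by rw [convolution_apply]; rfl
    rw [h1, hF, fourierInv_fourier_eq]
    simp_rw [h2, ← integral_const_mul]
    rw [integral_integral_swap]
    · refine integral_congr_ae (Filter.Eventually.of_forall fun ξ => ?_)
      simp only
      rw [hrep, ← integral_mul_const]
      refine integral_congr_ae (Filter.Eventually.of_forall fun ζ => ?_)
      simp only; ring
    · have hi := hFi.mul_prod ((integrable_weight_mul g K).const_mul D)
      refine hi.mono' ?_ (Filter.Eventually.of_forall fun p => ?_)
      · refine hFm.comp_fst.mul (Continuous.aestronglyMeasurable ?_)
        exact (g.continuous.comp continuous_snd).mul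
          (g'.continuous.comp (continuous_fst.sub continuous_snd))
      · simp only [Function.uncurry]
        calc ‖F p.1 * (g p.2 * g' (p.1 - p.2))‖ = ‖g p.2‖ * ‖F p.1 * g' (p.1 - p.2)‖ := by
              rw [norm_mul, norm_mul, norm_mul]; ring
          _ ≤ ‖g p.2‖ * (D * (1 + ‖p.2‖) ^ K * (‖F p.1‖ / (1 + ‖p.1‖) ^ K)) := by
              gcongr; exact hbd _ _
          _ = _ := by ring

theorem continuous_locFT (u : Distr) (θ : Test) : Continuous (locFT u θ) :=
  (locFT_representation u θ).1

theorem exists_locFT_growth (u : Distr) (θ : Test) :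
    ∃ (M : ℕ) (C : ℝ), 0 ≤ C ∧ ∀ ξ, ‖locFT u θ ξ‖ ≤ C * (1 + ‖ξ‖) ^ M :=
  (locFT_representation u θ).2.1

theorem cutFun_eq_integral (u : Distr) (θ : Test) (S : 𝓢(R3, ℂ)) :
    cutFun u θ S = ∫ ξ, locFT u θ ξ * 𝓕⁻ S ξ :=
  (locFT_representation u θ).2.2 S

theorem apply_prodTest_eq_integral (u : Distr) (θ φ : Test) :
    u (prodTest θ φ) = ∫ ξ, locFT u θ ξ * 𝓕⁻ φ.toSchwartz ξ := by
  rw [← cutFun_toSchwartz, cutFun_eq_integral]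

/-- The Fourier transform of `θ φ u` is the convolution of that of `θ u` with that of `φ`. -/
theorem locFT_prodTest (u : Distr) (θ φ : Test) (η : R3) :
    locFT u (prodTest θ φ) η = ∫ h, locFT u θ (η + h) * 𝓕⁻ φ.toSchwartz h := by
  rw [← cutFun_modulate, cutFun_eq_integral, ← integral_add_left_eq_self _ η]
  simp_rw [fourierInv_modulate, add_sub_cancel_left]

/-! ### Smoothness and rapid decay -/

/-- `F` decays faster than any power on the set `V`. -/
def RapidOn (F : R3 → ℂ) (V : Set R3) : Prop :=
  ∀ N : ℕ, ∃ C : ℝ, ∀ η ∈ V, ‖F η‖ ≤ C / (1 + ‖η‖) ^ N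

theorem RapidOn.mono {F : R3 → ℂ} {V W : Set R3} (h : RapidOn F V) (hW : W ⊆ V) : RapidOn F W :=
  fun N => (h N).imp fun _ hC η hη => hC η (hW hη)

theorem rapidOn_schwartz (g : 𝓢(R3, ℂ)) (V : Set R3) : RapidOn g V := fun N =>
  (exists_schwartz_decay g N).imp fun _ hC η _ => hC.2 η

theorem exists_nonneg_of_rapidOn {F : R3 → ℂ} {V : Set R3} (h : RapidOn F V) (N : ℕ) :
    ∃ C, 0 ≤ C ∧ ∀ η ∈ V, ‖F η‖ ≤ C / (1 + ‖η‖) ^ N := by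
  obtain ⟨C, hC⟩ := h N
  refine ⟨max C 0, le_max_right _ _, fun η hη => (hC η hη).trans ?_⟩
  have := one_le_weight η
  gcongr
  exact le_max_left _ _

theorem integrable_weight_inv : Integrable fun x : R3 => 1 / (1 + ‖x‖) ^ 4 := by
  have h : Integrable fun x : R3 => (1 + ‖x‖) ^ (-(4 : ℝ)) :=
    integrable_one_add_norm (by simp; norm_num)
  refine h.congr (Filter.Eventually.of_forall fun x => ?_)
  have := one_le_weight x
  simp only
  rw [Real.rpow_neg (by positivity), one_div]
  norm_cast

theorem RapidOn.integrable_weight_mul {F : R3 → ℂ} (hF : Continuous F)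
    (h : RapidOn F Set.univ) (n : ℕ) : Integrable fun x => (1 + ‖x‖) ^ n * ‖F x‖ := by
  obtain ⟨C, hC0, hC⟩ := exists_nonneg_of_rapidOn h (n + 4)
  refine (integrable_weight_inv.const_mul C).mono' (by fun_prop)
    (Filter.Eventually.of_forall fun x => ?_)
  have h1 := one_le_weight x
  rw [Real.norm_of_nonneg (by positivity)]
  calc _ ≤ (1 + ‖x‖) ^ n * (C / (1 + ‖x‖) ^ (n + 4)) := by gcongr; exact hC x trivial
    _ = C * (1 / (1 + ‖x‖) ^ 4) := by rw [pow_add]; field_simp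

/-- The quotient of a test function by a function that does not vanish near its support. -/
noncomputable def divTest (φ θ : Test) (h : tsupport φ ⊆ {x | θ x ≠ 0}) : Test where
  toFun x := φ x / θ x
  contDiff' := contDiff_iff_contDiffAt.2 fun x => by
    by_cases hx : x ∈ tsupport φ
    · exact φ.contDiff.contDiffAt.div θ.contDiff.contDiffAt (h hx)
    · refine (contDiffAt_const (c := (0 : ℝ))).congr_of_eventuallyEq ?_
      filter_upwards [notMem_tsupport_iff_eventuallyEq.1 hx] with y hy
      rw [hy]; simp
  hasCompactSupport' := φ.hasCompactSupport.mono fun x hx hx' => hx (by simp [hx'])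
  tsupport_subset' := fun _ _ => trivial

theorem prodTest_divTest (φ θ : Test) (h : tsupport φ ⊆ {x | θ x ≠ 0}) :
    prodTest θ (divTest φ θ h) = φ := by
  ext x
  change θ x * (φ x / θ x) = φ x
  by_cases hx : x ∈ tsupport φ
  · exact mul_div_cancel₀ _ (h hx)
  · rw [image_eq_zero_of_notMem_tsupport hx]; simp

/-- A distribution `u` is smooth where a cut-off `θ` does not vanish if the Fourier transform of
`θ u` is rapidly decreasing. By Fourier inversion `θ u` is then the smooth function `𝓕 L`, where
`L ξ = locFT u θ (-ξ)`, and a test function supported where `θ ≠ 0` is a multiple of `θ`. -/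
theorem isSmoothOn_of_rapidOn (u : Distr) (θ : Test) (h : RapidOn (locFT u θ) Set.univ) :
    IsSmoothOn u {x | θ x ≠ 0} := by
  have hc := continuous_locFT u θ
  set L : R3 → ℂ := fun ξ => locFT u θ (-ξ) with hL
  have hLc : Continuous L := hc.comp continuous_neg
  have hLr : RapidOn L Set.univ := fun N => by
    obtain ⟨C, hC⟩ := h N
    exact ⟨C, fun η _ => by simpa using hC (-η) trivial⟩
  have hLi : Integrable L := by
    have := hLr.integrable_weight_mul hLc 0
    simp only [pow_zero, one_mul] at this
    exact (integrable_norm_iff hLc.aestronglyMeasurable).1 this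
  have hLs : ContDiff ℝ ∞ (𝓕 L) := by
    refine Real.contDiff_fourier (N := ⊤) fun n _ => ?_
    refine (hLr.integrable_weight_mul hLc n).mono' (by fun_prop)
      (Filter.Eventually.of_forall fun x => ?_)
    rw [Real.norm_of_nonneg (by positivity)]
    gcongr
    linarith
  refine ⟨fun x => (θ x : ℂ)⁻¹ * 𝓕 L x, fun x hx => ?_, fun φ hφ => ?_⟩
  · refine ContDiffAt.contDiffWithinAt (ContDiffAt.mul (ContDiffAt.inv ?_ ?_) hLs.contDiffAt)
    · exact θ.contDiff_ofReal.contDiffAt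
    · exact_mod_cast hx
  · rw [← prodTest_divTest φ θ hφ, apply_prodTest_eq_integral]
    set φ' := divTest φ θ hφ with hφ'
    have h1 : ∫ ξ, locFT u θ ξ * 𝓕⁻ φ'.toSchwartz ξ = ∫ ξ, L ξ * 𝓕 φ'.toSchwartz ξ := by
      rw [← integral_neg_eq_self]
      refine integral_congr_ae (Filter.Eventually.of_forall fun ξ => ?_)
      simp only [SchwartzMap.fourierInv_coe, SchwartzMap.fourier_coe]
      rw [Real.fourierInv_eq_fourier_neg, neg_neg]
    have h2 : ∫ ξ, L ξ * 𝓕 φ'.toSchwartz ξ = ∫ x, 𝓕 L x * φ'.toSchwartz x := by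
      rw [SchwartzMap.fourier_coe]
      have := VectorFourier.integral_fourierIntegral_smul_eq_flip (μ := (volume : Measure R3))
        (ν := (volume : Measure R3)) (L := innerₗ R3) (f := L) (g := φ'.toSchwartz)
        Real.continuous_fourierChar continuous_inner hLi (φ'.toSchwartz.integrable)
      rw [flip_innerₗ] at this
      exact this.symm
    rw [h1, h2]
    refine integral_congr_ae (Filter.Eventually.of_forall fun x => ?_)
    simp only [Test.toSchwartz_apply, prodTest_apply, Complex.real_smul]
    by_cases hx : θ x = 0
    · have : φ' x = 0 := by change φ x / θ x = 0; rw [hx, div_zero]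
      simp [this]
    · have : (θ x : ℂ) ≠ 0 := by exact_mod_cast hx
      push_cast
      field_simp

theorem tsupport_mulTest_subset (g : R3 → ℝ) (hg : ContDiff ℝ ∞ g) (θ : Test) :
    tsupport (mulTest g hg θ) ⊆ tsupport θ :=
  closure_mono (Function.support_mul_subset_right g θ)

/-- Where `u` is given by a smooth function `f`, the Fourier transform of `θ u` is that of the
Schwartz function `θ f`, hence rapidly decreasing. -/
theorem IsSmoothOn.rapidOn {u : Distr} {U : Set R3} (hU : IsOpen U) (h : IsSmoothOn u U)
    {θ : Test} (hθ : tsupport θ ⊆ U) : RapidOn (locFT u θ) Set.univ := by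
  obtain ⟨f, hf, hu⟩ := h
  have hs : ContDiff ℝ ∞ fun x => (θ x : ℂ) * f x := contDiff_iff_contDiffAt.2 fun x => by
    by_cases hx : x ∈ tsupport θ
    · exact θ.contDiff_ofReal.contDiffAt.mul (hf.contDiffAt (hU.mem_nhds (hθ hx)))
    · refine (contDiffAt_const (c := (0 : ℂ))).congr_of_eventuallyEq ?_
      filter_upwards [notMem_tsupport_iff_eventuallyEq.1 hx] with y hy
      rw [hy]; simp
  have hcs : HasCompactSupport fun x => (θ x : ℂ) * f x :=
    θ.hasCompactSupport.mono fun x hx hx' => hx (by simp [hx'])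
  set S : 𝓢(R3, ℂ) := hcs.toSchwartzMap hs with hS
  have hSx : ∀ x, S x = θ x * f x := fun x => rfl
  have key : ∀ η, locFT u θ η = 𝓕 S η := by
    intro η
    rw [locFT, localFourier, hu _ ((tsupport_mulTest_subset _ _ θ).trans hθ),
      hu _ ((tsupport_mulTest_subset _ _ θ).trans hθ),
      ← integral_const_mul, ← integral_sub, SchwartzMap.fourier_coe, Real.fourier_eq']
    · refine integral_congr_ae (Filter.Eventually.of_forall fun x => ?_)
      simp only [mulTest_apply, inner_smul_right, Complex.real_smul, hSx, smul_eq_mul]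
      rw [Complex.exp_mul_I]
      push_cast
      rw [← neg_mul_eq_neg_mul, ← neg_mul_eq_neg_mul, Complex.cos_neg, Complex.sin_neg]
      ring
    · have := S.integrable (μ := volume).bdd_mul (c := 1)
        (f := fun x => ((Real.cos (inner ℝ x ((2 * Real.pi) • η)) : ℝ) : ℂ))
        (Continuous.aestronglyMeasurable (by fun_prop))
        (Filter.Eventually.of_forall fun x => by
          rw [Complex.norm_real]; exact Real.abs_cos_le_one _)
      refine this.congr (Filter.Eventually.of_forall fun x => ?_)
      simp [hSx, mul_assoc]
    · have := S.integrable (μ := volume).bdd_mul (c := 1)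
        (f := fun x => ((Real.sin (inner ℝ x ((2 * Real.pi) • η)) : ℝ) : ℂ))
        (Continuous.aestronglyMeasurable (by fun_prop))
        (Filter.Eventually.of_forall fun x => by
          rw [Complex.norm_real]; exact Real.abs_sin_le_one _)
      refine (this.congr (Filter.Eventually.of_forall fun x => ?_)).const_mul _
      simp [hSx, mul_assoc]
  rw [show locFT u θ = 𝓕 S from funext key]
  exact rapidOn_schwartz _ _

/-- Integration against a Schwartz function is bounded with respect to the weighted sup norms. -/
theorem exists_norm_integral_mul_le (g : 𝓢(R3, ℂ)) (K : ℕ) :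
    ∃ C, 0 ≤ C ∧ ∀ (H : R3 → ℂ) (A : ℝ), (∀ h, ‖H h‖ ≤ A * (1 + ‖h‖) ^ K) →
      ‖∫ h, H h * g h‖ ≤ C * A := by
  refine ⟨∫ h, (1 + ‖h‖) ^ K * ‖g h‖, integral_nonneg fun h => by positivity, fun H A hH => ?_⟩
  refine (norm_integral_le_of_norm_le ((integrable_weight_mul g K).const_mul A)
    (Filter.Eventually.of_forall fun h => ?_)).trans (le_of_eq ?_)
  · rw [norm_mul, ← mul_assoc]
    exact mul_le_mul_of_nonneg_right (hH h) (norm_nonneg _)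
  · rw [integral_const_mul, mul_comm]

theorem isOpen_compl_singsupp (u : Distr) : IsOpen (singsupp u)ᶜ := by
  rw [isOpen_iff_forall_mem_open]
  intro x hx
  simp only [singsupp, Set.mem_compl_iff, Set.mem_ofPred_eq, not_forall, not_not] at hx
  obtain ⟨U, hU, hxU, h⟩ := hx
  exact ⟨U, fun y hy hy' => hy' U hU hy h, hU, hxU⟩

theorem singsupp_subset_dsupport (u : Distr) : singsupp u ⊆ Distribution.dsupport u := by
  intro x hx
  by_contra h
  rw [Distribution.notMem_dsupport_iff] at h
  obtain ⟨U, hv, hU, hxU⟩ := h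
  refine hx U hU hxU ⟨fun _ => 0, contDiffOn_const, fun φ hφ => ?_⟩
  rw [hv φ hφ]; simp

/-! ### Localization by partitions of unity -/

theorem sum_test_apply {ι : Type*} (s : Finset ι) (f : ι → Test) (x : R3) :
    (∑ i ∈ s, f i) x = ∑ i ∈ s, f i x := by
  classical
  induction s using Finset.induction_on with
  | empty => simp
  | insert a s ha ih => rw [Finset.sum_insert ha, Finset.sum_insert ha, ← ih]; rfl

/-- A test function is a finite sum of multiples of given test functions `Θ x`, if `Θ x` does not
vanish at `x` for each `x` in its support. -/
theorem exists_eq_sum_prodTest (φ : Test) (Θ : R3 → Test) (hΘ : ∀ x ∈ tsupport φ, Θ x x ≠ 0) :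
    ∃ (t : Finset R3) (ρ : R3 → Test), (∀ x ∈ t, x ∈ tsupport φ) ∧
      φ = ∑ x ∈ t, prodTest (Θ x) (ρ x) := by
  obtain ⟨t, htφ, ht⟩ := IsCompact.elim_nhds_subcover φ.hasCompactSupport
    (fun x => {y | Θ x y ≠ 0})
    (fun x hx => ((Θ x).continuous.isOpen_preimage _ isOpen_compl_singleton).mem_nhds (hΘ x hx))
  -- The squares of the `Θ x` have a positive sum on the support.
  set σ : Test := ∑ x ∈ t, prodTest (Θ x) (Θ x) with hσ
  have hσ0 : tsupport φ ⊆ {y | σ y ≠ 0} := by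
    intro y hy
    obtain ⟨x, hx, hxy⟩ := Set.mem_iUnion₂.1 (ht hy)
    rw [Set.mem_ofPred_eq, hσ, sum_test_apply]
    refine ne_of_gt (Finset.sum_pos' (fun i _ => ?_) ⟨x, hx, ?_⟩)
    · exact mul_self_nonneg _
    · exact mul_self_pos.2 hxy
  refine ⟨t, fun x => prodTest (Θ x) (divTest φ σ hσ0), htφ, ?_⟩
  conv_lhs => rw [← prodTest_divTest φ σ hσ0]
  ext y
  rw [sum_test_apply, prodTest_apply, show σ y = _ from sum_test_apply t _ y, Finset.sum_mul]
  simp only [prodTest_apply, mul_assoc]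

theorem tsupport_prodTest_subset_left (θ φ : Test) : tsupport (prodTest θ φ) ⊆ tsupport θ :=
  closure_mono (Function.support_mul_subset_left θ φ)

theorem tsupport_prodTest_subset_right (θ φ : Test) : tsupport (prodTest θ φ) ⊆ tsupport φ :=
  closure_mono (Function.support_mul_subset_right θ φ)

/-- A distribution vanishes on test functions supported off its support. -/
theorem apply_eq_zero_of_disjoint_dsupport (u : Distr) (φ : Test)
    (h : Disjoint (tsupport φ) (Distribution.dsupport u)) : u φ = 0 := by
  have h1 : ∀ x : R3, ∃ θ : Test, x ∈ tsupport φ → θ x ≠ 0 ∧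
      Distribution.IsVanishingOn u (tsupport θ) := by
    intro x
    by_cases hx : x ∈ tsupport φ
    · obtain ⟨U, hv, hU, hxU⟩ := (Distribution.notMem_dsupport_iff x).1 (h.notMem_of_mem_left hx)
      obtain ⟨θ, hθU, -, W, -, hxW, hW⟩ := exists_test_eq_one (isCompact_singleton (x := x)) hU
        (Set.singleton_subset_iff.2 hxU)
      refine ⟨θ, fun _ => ⟨?_, hv.mono hθU⟩⟩
      rw [hW x (Set.singleton_subset_iff.1 hxW)]
      exact one_ne_zero
    · exact ⟨0, fun h => absurd h hx⟩
  choose Θ hΘ using h1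
  obtain ⟨t, ρ, htφ, hφ⟩ := exists_eq_sum_prodTest φ Θ fun x hx => (hΘ x hx).1
  rw [hφ, map_sum]
  exact Finset.sum_eq_zero fun x hx =>
    (hΘ x (htφ x hx)).2 _ (tsupport_prodTest_subset_left _ _)

/-- A distribution does not change when multiplied by a cut-off equal to `1` near its support. -/
theorem apply_prodTest_of_eq_one (u : Distr) (θ : Test) {W : Set R3} (hW : IsOpen W)
    (hu : Distribution.dsupport u ⊆ W) (hθ : ∀ x ∈ W, θ x = 1) (φ : Test) :
    u (prodTest θ φ) = u φ := by
  rw [← sub_eq_zero, ← map_sub]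
  refine apply_eq_zero_of_disjoint_dsupport u _ (Set.disjoint_left.2 fun x hx hxu => ?_)
  have : tsupport (prodTest θ φ - φ : Test) ⊆ Wᶜ :=
    closure_minimal (fun y hy hyW => hy (by
      change θ y * φ y - φ y = 0
      rw [hθ y hyW]; ring)) hW.isClosed_compl
  exact this hx (hu hxu)

/-! ### Rapid decay near the characteristic cone -/

theorem locFT_add (u : Distr) (θ φ : Test) (ξ : R3) :
    locFT u (θ + φ) ξ = locFT u θ ξ + locFT u φ ξ := by
  have h : ∀ (g : R3 → ℝ) (hg : ContDiff ℝ ∞ g),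
      mulTest g hg (θ + φ) = mulTest g hg θ + mulTest g hg φ := fun g hg => by
    ext x; simp [mul_add]
  rw [locFT, localFourier, h, h, map_add, map_add, locFT, locFT, localFourier, localFourier]
  ring

theorem locFT_zero (u : Distr) (ξ : R3) : locFT u 0 ξ = 0 := by
  have := locFT_add u 0 0 ξ
  simpa using this

theorem RapidOn.add {F G : R3 → ℂ} {V : Set R3} (hF : RapidOn F V) (hG : RapidOn G V) :
    RapidOn (fun ξ => F ξ + G ξ) V := fun N => by
  obtain ⟨C, hC⟩ := hF N
  obtain ⟨D, hD⟩ := hG N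
  refine ⟨C + D, fun η hη => (norm_add_le _ _).trans ?_⟩
  rw [add_div]
  exact add_le_add (hC η hη) (hD η hη)

theorem RapidOn.union {F : R3 → ℂ} {V W : Set R3} (hV : RapidOn F V) (hW : RapidOn F W) :
    RapidOn F (V ∪ W) := fun N => by
  obtain ⟨C, hC⟩ := hV N
  obtain ⟨D, hD⟩ := hW N
  refine ⟨max C D, fun η hη => ?_⟩
  have := one_le_weight η
  rcases hη with h | h
  · exact (hC η h).trans (by gcongr; exact le_max_left _ _)
  · exact (hD η h).trans (by gcongr; exact le_max_right _ _)

/-- Multiplication by a further cut-off preserves rapid decay on slightly smaller cones: in the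
convolution with `𝓕⁻ φ`, increments `h` that are small against `η` stay in the cone, and for the
others the decay of `𝓕⁻ φ` in `h` is one in `η`. -/
theorem RapidOn.prodTest {u : Distr} {θ : Test} {V : Set R3} (hV : RapidOn (locFT u θ) V)
    (φ : Test) {V' : Set R3} {δ : ℝ} (hδ : 0 < δ)
    (hVV' : ∀ η ∈ V', ∀ h : R3, ‖h‖ < δ * ‖η‖ → η + h ∈ V) :
    RapidOn (locFT u (prodTest θ φ)) V' := by
  intro N
  obtain ⟨M, D, hD0, hD⟩ := exists_locFT_growth u θ
  obtain ⟨C, hC0, hC⟩ := exists_nonneg_of_rapidOn hV N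
  obtain ⟨E, hE0, hE⟩ := exists_norm_integral_mul_le (𝓕⁻ φ.toSchwartz) (M + (M + N))
  have hδ1 : 0 ≤ (1 + 1 / δ) := by positivity
  refine ⟨E * (C + D * (1 + 1 / δ) ^ (M + N)), fun η hη => ?_⟩
  rw [locFT_prodTest, mul_div_assoc]
  refine hE _ _ fun h => ?_
  have h1 := one_le_weight η
  have h2 := one_le_weight h
  rw [add_div, add_mul]
  by_cases hh : ‖h‖ < δ * ‖η‖
  · refine le_trans ?_ (le_add_of_nonneg_right (by positivity))
    refine (hC _ (hVV' η hη h hh)).trans ?_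
    have h3 := one_le_weight (η + h)
    have h4 : (1 + ‖η‖) ^ N ≤ (1 + ‖η + h‖) ^ N * (1 + ‖h‖) ^ N := by
      rw [← mul_pow]
      gcongr
      have := weight_add_le (η + h) (-h)
      simpa using this
    rw [div_mul_eq_mul_div, div_le_div_iff₀ (by positivity) (by positivity)]
    calc C * (1 + ‖η‖) ^ N ≤ C * ((1 + ‖η + h‖) ^ N * (1 + ‖h‖) ^ N) := by gcongr
      _ ≤ C * ((1 + ‖η + h‖) ^ N * (1 + ‖h‖) ^ (M + (M + N))) := by
          gcongr
          omega
      _ = _ := by ring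
  · refine le_trans ?_ (le_add_of_nonneg_left (by positivity))
    refine (hD _).trans ?_
    rw [not_lt] at hh
    have h3 : 1 + ‖η‖ ≤ (1 + 1 / δ) * (1 + ‖h‖) := by
      have : ‖η‖ ≤ 1 / δ * ‖h‖ := by
        rw [div_mul_eq_mul_div, one_mul, le_div_iff₀ hδ]; linarith
      have h5 : 0 ≤ 1 / δ := by positivity
      nlinarith [norm_nonneg h]
    have h4 : (1 + ‖η + h‖) ^ M ≤ (1 + ‖η‖) ^ M * (1 + ‖h‖) ^ M := by
      rw [← mul_pow]; gcongr; exact weight_add_le η h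
    have h6 : (1 + ‖η‖) ^ (M + N) ≤ (1 + 1 / δ) ^ (M + N) * (1 + ‖h‖) ^ (M + N) := by
      rw [← mul_pow]; gcongr
    rw [div_mul_eq_mul_div, le_div_iff₀ (by positivity)]
    calc D * (1 + ‖η + h‖) ^ M * (1 + ‖η‖) ^ N
        ≤ D * ((1 + ‖η‖) ^ M * (1 + ‖h‖) ^ M) * (1 + ‖η‖) ^ N := by gcongr
      _ = D * (1 + ‖h‖) ^ M * (1 + ‖η‖) ^ (M + N) := by ring
      _ ≤ D * (1 + ‖h‖) ^ M * ((1 + 1 / δ) ^ (M + N) * (1 + ‖h‖) ^ (M + N)) := by gcongr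
      _ = _ := by ring

/-- The open cone spanned by the ball of radius `δ` around `ξ`. -/
def coneAround (ξ : R3) (δ : ℝ) : Set R3 := {η | ∃ t : ℝ, 0 < t ∧ ‖η - t • ξ‖ < δ * t}

theorem coneAround_mono (ξ : R3) {δ ε : ℝ} (h : δ ≤ ε) : coneAround ξ δ ⊆ coneAround ξ ε := by
  rintro η ⟨t, ht, h1⟩
  exact ⟨t, ht, h1.trans_le (by gcongr)⟩

theorem isOpen_coneAround (ξ : R3) (δ : ℝ) : IsOpen (coneAround ξ δ) := by
  have : coneAround ξ δ = ⋃ t : Set.Ioi (0 : ℝ), {η | ‖η - (t : ℝ) • ξ‖ < δ * t} := by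
    ext η; simp [coneAround]
  rw [this]
  exact isOpen_iUnion fun t => isOpen_lt (by fun_prop) (by fun_prop)

theorem self_mem_coneAround (ξ : R3) {δ : ℝ} (hδ : 0 < δ) : ξ ∈ coneAround ξ δ :=
  ⟨1, one_pos, by simpa using hδ⟩

theorem smul_mem_coneAround {ξ η : R3} {δ : ℝ} (h : η ∈ coneAround ξ δ) {s : ℝ} (hs : 0 < s) :
    s • η ∈ coneAround ξ δ := by
  obtain ⟨t, ht, h1⟩ := h
  refine ⟨s * t, by positivity, ?_⟩
  rw [mul_smul, ← smul_sub, norm_smul, Real.norm_of_nonneg hs.le]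
  nlinarith

theorem exists_coneAround_subset {V : Set R3} (hV : IsOpen V) (hVc : IsConic V) {ξ : R3}
    (hξ : ξ ∈ V) : ∃ δ, 0 < δ ∧ coneAround ξ δ ⊆ V := by
  obtain ⟨δ, hδ, h⟩ := Metric.isOpen_iff.1 hV ξ hξ
  refine ⟨δ, hδ, ?_⟩
  rintro η ⟨t, ht, h1⟩
  have h2 : t⁻¹ • η ∈ V := by
    refine h ?_
    rw [mem_ball_iff_norm]
    have : t⁻¹ • η - ξ = t⁻¹ • (η - t • ξ) := by
      rw [smul_sub, smul_smul, inv_mul_cancel₀ ht.ne', one_smul]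
    rw [this, norm_smul, Real.norm_of_nonneg (by positivity), inv_mul_lt_iff₀ ht]
    linarith
  have := hVc _ h2 t ht
  rwa [smul_smul, mul_inv_cancel₀ ht.ne', one_smul] at this

/-- Microlocal smoothness at all points over the support of `θ`, in the direction `ξ`, makes the
Fourier transform of `θ u` decay rapidly in a cone around `ξ`. -/
theorem exists_rapidOn_coneAround (u : Distr) (θ : Test) (ξ : R3)
    (h : ∀ x, IsMicroSmoothAt u x ξ) :
    ∃ δ, 0 < δ ∧ RapidOn (locFT u θ) (coneAround ξ δ) := by
  choose Θ hΘ V hV hVc hξV hr using h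
  obtain ⟨t, ρ, -, hθ⟩ := exists_eq_sum_prodTest θ Θ fun x _ => hΘ x
  have step : ∀ x, ∃ δ, 0 < δ ∧ RapidOn (locFT u (prodTest (Θ x) (ρ x))) (coneAround ξ δ) := by
    intro x
    obtain ⟨δ, hδ, hδV⟩ := exists_coneAround_subset (hV x) (hVc x) (hξV x)
    have hrV : RapidOn (locFT u (Θ x)) (V x) := by
      intro N
      obtain ⟨C, hC⟩ := hr x N
      refine ⟨max C 0, fun η hη => ?_⟩
      have hpi : (1 : ℝ) ≤ 2 * Real.pi := by linarith [Real.pi_gt_three]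
      refine (hC _ (hVc x η hη (2 * Real.pi) (by positivity))).trans ?_
      have h1 := one_le_weight η
      have h2 : 1 + ‖η‖ ≤ 1 + ‖(2 * Real.pi) • η‖ := by
        rw [norm_smul, Real.norm_of_nonneg (by positivity)]
        nlinarith [norm_nonneg η]
      calc C / (1 + ‖(2 * Real.pi) • η‖) ^ N ≤ max C 0 / (1 + ‖(2 * Real.pi) • η‖) ^ N := by
            gcongr; exact le_max_left _ _
        _ ≤ _ := by gcongr
    refine ⟨δ / 2, by positivity, hrV.prodTest (ρ x) (δ := (δ / 2) / (‖ξ‖ + δ)) (by positivity) ?_⟩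
    rintro η ⟨t, ht, h1⟩ h hh
    refine hδV ⟨t, ht, ?_⟩
    have h2 : ‖η‖ ≤ (‖ξ‖ + δ) * t := by
      have := norm_sub_norm_le η (t • ξ)
      rw [norm_smul, Real.norm_of_nonneg ht.le] at this
      nlinarith
    have h3 : ‖h‖ < δ / 2 * t := by
      refine hh.trans_le ?_
      rw [div_mul_eq_mul_div, div_le_iff₀ (by positivity)]
      nlinarith
    calc ‖η + h - t • ξ‖ = ‖(η - t • ξ) + h‖ := by congr 1; abel
      _ ≤ _ := norm_add_le _ _
      _ < δ * t := by linarith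
  have sum : ∀ s : Finset R3, ∃ δ, 0 < δ ∧
      RapidOn (locFT u (∑ x ∈ s, prodTest (Θ x) (ρ x))) (coneAround ξ δ) := by
    intro s
    classical
    induction s using Finset.induction_on with
    | empty =>
      refine ⟨1, one_pos, fun N => ⟨0, fun η _ => ?_⟩⟩
      rw [Finset.sum_empty, locFT_zero]; simp
    | insert a s ha ih =>
      obtain ⟨δ, hδ, h1⟩ := ih
      obtain ⟨ε, hε, h2⟩ := step a
      refine ⟨min δ ε, lt_min hδ hε, ?_⟩
      rw [Finset.sum_insert ha]
      rw [show locFT u (prodTest (Θ a) (ρ a) + ∑ x ∈ s, prodTest (Θ x) (ρ x)) = fun η =>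
        locFT u (prodTest (Θ a) (ρ a)) η + locFT u (∑ x ∈ s, prodTest (Θ x) (ρ x)) η from
        funext fun η => locFT_add _ _ _ _]
      exact (h2.mono (coneAround_mono ξ (min_le_right _ _))).add
        (h1.mono (coneAround_mono ξ (min_le_left _ _)))
  rw [hθ]
  exact sum t

theorem continuous_symbol : Continuous symbol := by
  unfold symbol; fun_prop

theorem symbol_smul (t : ℝ) (ξ : R3) : symbol (t • ξ) = t ^ 2 * symbol ξ := by
  simp only [symbol, PiLp.smul_apply, smul_eq_mul, norm_smul, Real.norm_eq_abs, mul_pow, sq_abs]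
  ring

/-- If the wave front set of `u` avoids the characteristic set, the Fourier transform of `θ u`
decays rapidly in a conic neighbourhood of the characteristic cone. -/
theorem exists_rapidOn_near_cone (u : Distr) (θ : Test) (h : WF u ∩ charSet = ∅) :
    ∃ ε, 0 < ε ∧ RapidOn (locFT u θ) {ξ | |symbol ξ| < ε * ‖ξ‖ ^ 2} := by
  have h1 : ∀ ξ : R3, ξ ≠ 0 → symbol ξ = 0 → ∃ δ, 0 < δ ∧ RapidOn (locFT u θ) (coneAround ξ δ) := by
    intro ξ hξ hs
    refine exists_rapidOn_coneAround u θ ξ fun x => ?_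
    by_contra hx
    have : (x, ξ) ∈ WF u ∩ charSet := ⟨⟨hξ, hx⟩, hs⟩
    rw [h] at this
    exact this
  have h2 : ∀ ξ : R3, ∃ δ, ξ ≠ 0 → symbol ξ = 0 → 0 < δ ∧ RapidOn (locFT u θ) (coneAround ξ δ) := by
    intro ξ
    by_cases hξ : ξ ≠ 0 ∧ symbol ξ = 0
    · obtain ⟨δ, h⟩ := h1 ξ hξ.1 hξ.2
      exact ⟨δ, fun _ _ => h⟩
    · exact ⟨0, fun h3 h4 => absurd ⟨h3, h4⟩ hξ⟩
  choose δ hδ using h2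
  have hΓ : IsCompact (Metric.sphere (0 : R3) 1 ∩ symbol ⁻¹' {0}) :=
    (isCompact_sphere 0 1).inter_right (isClosed_singleton.preimage continuous_symbol)
  have hne : ∀ ξ ∈ Metric.sphere (0 : R3) 1, ξ ≠ 0 := fun ξ hξ h0 => by
    simp [h0] at hξ
  obtain ⟨t, htΓ, ht⟩ := hΓ.elim_nhds_subcover (fun ξ => coneAround ξ (δ ξ)) fun ξ hξ =>
    (isOpen_coneAround ξ (δ ξ)).mem_nhds (self_mem_coneAround ξ (hδ ξ (hne ξ hξ.1) hξ.2).1)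
  set W := ⋃ ξ ∈ t, coneAround ξ (δ ξ) with hW
  have hWo : IsOpen W := isOpen_biUnion fun ξ _ => isOpen_coneAround ξ (δ ξ)
  have hWr : RapidOn (locFT u θ) W := by
    have : ∀ s : Finset R3, (∀ ξ ∈ s, ξ ∈ Metric.sphere (0 : R3) 1 ∩ symbol ⁻¹' {0}) →
        RapidOn (locFT u θ) (⋃ ξ ∈ s, coneAround ξ (δ ξ)) := by
      intro s
      classical
      induction s using Finset.induction_on with
      | empty => intro _ N; exact ⟨0, by simp⟩
      | insert a s ha ih =>
        intro hs
        rw [Finset.set_biUnion_insert]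
        have ha' := hs a (Finset.mem_insert_self _ _)
        exact (hδ a (hne a ha'.1) ha'.2).2.union
          (ih fun ξ hξ => hs ξ (Finset.mem_insert_of_mem hξ))
    exact this t htΓ
  have hWc : ∀ ξ ∈ W, ∀ s : ℝ, 0 < s → s • ξ ∈ W := by
    intro ξ hξ s hs
    obtain ⟨a, ha, h⟩ := Set.mem_iUnion₂.1 hξ
    exact Set.mem_iUnion₂.2 ⟨a, ha, smul_mem_coneAround h hs⟩
  have hK : IsCompact (Metric.sphere (0 : R3) 1 \ W) := (isCompact_sphere 0 1).diff hWo
  -- On the compact set of unit vectors outside `W`, the symbol is bounded away from zero.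
  obtain ⟨ε, hε, hεK⟩ : ∃ ε, 0 < ε ∧ ∀ ξ ∈ Metric.sphere (0 : R3) 1 \ W, ε ≤ |symbol ξ| := by
    rcases (Metric.sphere (0 : R3) 1 \ W).eq_empty_or_nonempty with he | hn
    · exact ⟨1, one_pos, by simp [he]⟩
    · obtain ⟨ξ₀, hξ₀, hmin⟩ := hK.exists_isMinOn hn continuous_symbol.abs.continuousOn
      refine ⟨|symbol ξ₀|, abs_pos.2 fun h0 => hξ₀.2 (ht ⟨hξ₀.1, h0⟩), fun ξ hξ => hmin hξ⟩
  refine ⟨ε, hε, hWr.mono fun ξ hξ => ?_⟩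
  have hξ0 : ξ ≠ 0 := by
    rintro rfl
    simp [symbol] at hξ
  have hn : 0 < ‖ξ‖ := norm_pos_iff.2 hξ0
  by_contra hξW
  have h3 : ‖ξ‖⁻¹ • ξ ∈ Metric.sphere (0 : R3) 1 \ W := by
    refine ⟨by simp [norm_smul, hn.ne'], fun h => hξW ?_⟩
    have := hWc _ h ‖ξ‖ hn
    rwa [smul_smul, mul_inv_cancel₀ hn.ne', one_smul] at this
  have h4 := hεK _ h3
  rw [symbol_smul, abs_mul, abs_of_nonneg (by positivity), inv_pow, ← div_eq_inv_mul,
    le_div_iff₀ (by positivity)] at h4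
  exact absurd hξ (not_lt.2 h4)

/-! ### Taylor expansion of homogeneous functions -/

theorem abs_apply_le_norm (h : R3) (i : Fin 3) : |h i| ≤ ‖h‖ := by
  simpa using PiLp.norm_apply_le h i

theorem sum_smul_e (h : R3) : ∑ i, h i • e i = h := by
  have := (EuclideanSpace.basisFun (Fin 3) ℝ).sum_repr h
  simpa [e] using this

theorem norm_e (i : Fin 3) : ‖e i‖ = 1 := by simp [e]

theorem abs_prod_apply_le (h : R3) {k : ℕ} (r : Fin k → Fin 3) : |∏ i, h (r i)| ≤ ‖h‖ ^ k := by
  rw [Finset.abs_prod]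
  calc ∏ i, |h (r i)| ≤ ∏ _i : Fin k, ‖h‖ :=
        Finset.prod_le_prod (fun i _ => abs_nonneg _) fun i _ => abs_apply_le_norm h _
    _ = ‖h‖ ^ k := by simp

theorem multilinear_apply_eq_sum {k : ℕ} (f : ContinuousMultilinearMap ℝ (fun _ : Fin k => R3) ℝ)
    (h : R3) : f (fun _ => h) = ∑ r : Fin k → Fin 3, f (fun i => e (r i)) * ∏ i, h (r i) := by
  conv_lhs => rw [← sum_smul_e h]
  rw [f.map_sum]
  refine Finset.sum_congr rfl fun r _ => ?_
  rw [f.map_smul_univ, smul_eq_mul, mul_comm]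

/-- Taylor expansion, uniform in the base point and at all scales, of a function that is homogeneous
of degree zero and smooth away from the origin. By homogeneity it suffices to expand at unit
vectors; for large increments the estimate is trivial. -/
theorem exists_taylor_homogeneous {b : R3 → ℝ} (hb : ContDiffOn ℝ ∞ b {0}ᶜ)
    (hhom : ∀ t : ℝ, 0 < t → ∀ ξ, b (t • ξ) = b ξ) {B : ℝ} (hB : ∀ ξ, |b ξ| ≤ B) (n : ℕ) :
    ∃ C, 0 ≤ C ∧ ∀ η : R3, 1 ≤ ‖η‖ → ∃ c : (k : ℕ) → (Fin k → Fin 3) → ℝ,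
      (∀ k ∈ Finset.range (n + 1), ∀ r, |c k r| ≤ C) ∧
      ∀ h : R3, |b (η + h) - ∑ k ∈ Finset.range (n + 1), ∑ r, c k r * ∏ i, h (r i)| ≤
        C * (1 + ‖h‖) ^ (2 * (n + 1)) / ‖η‖ ^ (n + 1) := by
  have hB0 : 0 ≤ B := (abs_nonneg _).trans (hB 0)
  -- The derivatives of `b` are bounded on a neighbourhood of the unit sphere.
  have hA : IsCompact (Metric.closedBall (0 : R3) 2 \ Metric.ball 0 (1 / 2)) :=
    (isCompact_closedBall 0 2).diff Metric.isOpen_ball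
  have hmemA : ∀ x : R3, 1 / 2 ≤ ‖x‖ → ‖x‖ ≤ 2 →
      x ∈ Metric.closedBall (0 : R3) 2 \ Metric.ball 0 (1 / 2) := fun x h1 h2 =>
    ⟨by simpa using h2, by simpa using h1⟩
  have hsm : ∀ x : R3, 1 / 2 ≤ ‖x‖ → ContDiffAt ℝ ∞ b x := fun x hx =>
    hb.contDiffAt (isOpen_compl_singleton.mem_nhds (norm_pos_iff.1 (by linarith)))
  have hD : ∀ k : ℕ, ∃ D, 0 ≤ D ∧ ∀ x : R3, 1 / 2 ≤ ‖x‖ → ‖x‖ ≤ 2 →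
      ‖iteratedFDeriv ℝ k b x‖ ≤ D := by
    intro k
    have hc : ContinuousOn (iteratedFDeriv ℝ k b)
        (Metric.closedBall (0 : R3) 2 \ Metric.ball 0 (1 / 2)) := fun x hx =>
      ((hsm x (by simpa using hx.2)).continuousAt_iteratedFDeriv
        (by exact_mod_cast le_top)).continuousWithinAt
    obtain ⟨D, hD⟩ := hA.exists_bound_of_continuousOn hc
    exact ⟨max D 0, le_max_right _ _, fun x h1 h2 => (hD x (hmemA x h1 h2)).trans (le_max_left _ _)⟩
  choose D hD0 hD using hD
  set S : ℝ := ∑ k ∈ Finset.range (n + 2), D k with hS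
  have hDS : ∀ k ∈ Finset.range (n + 2), D k ≤ S := fun k hk =>
    Finset.single_le_sum (fun i _ => hD0 i) hk
  have hS0 : 0 ≤ S := Finset.sum_nonneg fun i _ => hD0 i
  set Q : ℝ := ∑ k ∈ Finset.range (n + 1), (3 : ℝ) ^ k with hQ
  have hQ0 : 0 ≤ Q := Finset.sum_nonneg fun i _ => by positivity
  set C : ℝ := S + (B + Q * S) * 2 ^ (n + 1) with hC
  have hSC : S ≤ C := by rw [hC]; have : 0 ≤ (B + Q * S) * 2 ^ (n + 1) := by positivity
                         linarith
  have hC0 : 0 ≤ C := hS0.trans hSC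
  refine ⟨C, hC0, fun η hη => ?_⟩
  have hη0 : 0 < ‖η‖ := by linarith
  set v : R3 := ‖η‖⁻¹ • η with hv
  have hv1 : ‖v‖ = 1 := by rw [hv, norm_smul, norm_inv, norm_norm, inv_mul_cancel₀ hη0.ne']
  let c : (k : ℕ) → (Fin k → Fin 3) → ℝ := fun k r =>
    (k.factorial : ℝ)⁻¹ * (‖η‖⁻¹) ^ k * iteratedFDeriv ℝ k b v (fun i => e (r i))
  have hinv1 : ‖η‖⁻¹ ≤ 1 := inv_le_one_of_one_le₀ hη
  have hcS : ∀ k ∈ Finset.range (n + 1), ∀ r, |c k r| ≤ S := by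
    intro k hk r
    have h1 : |iteratedFDeriv ℝ k b v (fun i => e (r i))| ≤ S := by
      have := (iteratedFDeriv ℝ k b v).le_opNorm (fun i => e (r i))
      simp only [norm_e, Finset.prod_const_one, mul_one, Real.norm_eq_abs] at this
      refine this.trans ((hD k v (by rw [hv1]; norm_num) (by rw [hv1]; norm_num)).trans (hDS k ?_))
      simp only [Finset.mem_range] at hk ⊢; omega
    have h2 : (k.factorial : ℝ)⁻¹ ≤ 1 :=
      inv_le_one_of_one_le₀ (by exact_mod_cast Nat.one_le_iff_ne_zero.2 k.factorial_ne_zero)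
    have h3 : (‖η‖⁻¹) ^ k ≤ 1 := pow_le_one₀ (by positivity) hinv1
    simp only [c]
    rw [abs_mul, abs_of_nonneg (by positivity)]
    calc _ ≤ 1 * S := by
          refine mul_le_mul ?_ h1 (abs_nonneg _) zero_le_one
          exact mul_le_one₀ h2 (by positivity) h3
      _ = S := one_mul S
  refine ⟨c, fun k hk r => (hcS k hk r).trans hSC, fun h => ?_⟩
  have hw := one_le_weight h
  -- For `‖h‖ ≤ ‖η‖ / 2` the segment from `v` to `v + y` stays away from the origin; otherwise `‖η‖` is
  -- bounded by a multiple of the weight of `h`.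
  by_cases hh : ‖h‖ ≤ ‖η‖ / 2
  · set y : R3 := ‖η‖⁻¹ • h with hy
    have hyn : ‖y‖ = ‖η‖⁻¹ * ‖h‖ := by rw [hy, norm_smul, norm_inv, norm_norm]
    have hy2 : ‖y‖ ≤ 1 / 2 := by
      rw [hyn, inv_mul_le_iff₀ hη0]; linarith
    have hseg : ∀ t : ℝ, t ∈ Set.Icc (0 : ℝ) 1 → 1 / 2 ≤ ‖v + t • y‖ ∧ ‖v + t • y‖ ≤ 2 := by
      intro t ht
      have h1 : ‖t • y‖ ≤ 1 / 2 := by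
        rw [norm_smul, Real.norm_of_nonneg ht.1]
        nlinarith [ht.2, norm_nonneg y]
      have h2 := norm_add_le v (t • y)
      have h3 := norm_sub_le_norm_add v (t • y)
      constructor <;> linarith
    have htay := map_add_eq_sum_add_integral_iteratedFDeriv (f := b) (x := v) (y := y) (n := n)
      fun t ht => (hsm _ (hseg t ht).1).of_le (by exact_mod_cast le_top)
    have hbη : b (η + h) = b (v + y) := by
      rw [hv, hy, ← smul_add, hhom _ (by positivity)]
    have hpoly : ∀ k, (k.factorial : ℝ)⁻¹ • iteratedFDeriv ℝ k b v (fun _ => y) =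
        ∑ r, c k r * ∏ i, h (r i) := by
      intro k
      rw [multilinear_apply_eq_sum, smul_eq_mul, Finset.mul_sum]
      refine Finset.sum_congr rfl fun r _ => ?_
      simp only [hy, PiLp.smul_apply, smul_eq_mul, Finset.prod_mul_distrib, Finset.prod_const,
        Finset.card_univ, Fintype.card_fin, c]
      ring
    rw [hbη, htay, Finset.sum_congr rfl fun k _ => hpoly k, add_sub_cancel_left]
    have hint : ‖∫ t in (0 : ℝ)..1, (1 - t) ^ n • iteratedFDeriv ℝ (n + 1) b (v + t • y) fun _ => y‖
        ≤ (S * ‖y‖ ^ (n + 1)) * |(1 : ℝ) - 0| := by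
      refine intervalIntegral.norm_integral_le_of_norm_le_const fun t ht => ?_
      rw [Set.uIoc_of_le zero_le_one] at ht
      have ht' : t ∈ Set.Icc (0 : ℝ) 1 := ⟨ht.1.le, ht.2⟩
      rw [norm_smul]
      have h1 : ‖(1 - t) ^ n‖ ≤ 1 := by
        rw [norm_pow]
        refine pow_le_one₀ (norm_nonneg _) ?_
        rw [Real.norm_eq_abs, abs_le]; constructor <;> linarith [ht'.1, ht'.2]
      have h2 : ‖iteratedFDeriv ℝ (n + 1) b (v + t • y) fun _ => y‖ ≤ S * ‖y‖ ^ (n + 1) := by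
        refine ((iteratedFDeriv ℝ (n + 1) b (v + t • y)).le_opNorm _).trans ?_
        simp only [Finset.prod_const, Finset.card_univ, Fintype.card_fin]
        gcongr
        exact (hD _ _ (hseg t ht').1 (hseg t ht').2).trans (hDS _ (by simp))
      calc _ ≤ 1 * (S * ‖y‖ ^ (n + 1)) := mul_le_mul h1 h2 (norm_nonneg _) zero_le_one
        _ = _ := one_mul _
    rw [sub_zero, abs_one, mul_one] at hint
    rw [smul_eq_mul, abs_mul, abs_of_nonneg (by positivity)]
    have hfac : (n.factorial : ℝ)⁻¹ ≤ 1 :=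
      inv_le_one_of_one_le₀ (by exact_mod_cast Nat.one_le_iff_ne_zero.2 n.factorial_ne_zero)
    calc _ ≤ 1 * (S * ‖y‖ ^ (n + 1)) :=
          mul_le_mul hfac hint (abs_nonneg _) zero_le_one
      _ = S * ‖h‖ ^ (n + 1) / ‖η‖ ^ (n + 1) := by
          rw [hyn, mul_pow, inv_pow, one_mul]; field_simp
      _ ≤ _ := by
          gcongr
          calc ‖h‖ ^ (n + 1) ≤ (1 + ‖h‖) ^ (n + 1) := by gcongr; linarith
            _ ≤ _ := pow_le_pow_right₀ hw (by omega)
  · rw [not_le] at hh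
    have hsum : |∑ k ∈ Finset.range (n + 1), ∑ r, c k r * ∏ i, h (r i)| ≤
        Q * S * (1 + ‖h‖) ^ (n + 1) := by
      refine (Finset.abs_sum_le_sum_abs _ _).trans ?_
      rw [hQ, Finset.sum_mul, Finset.sum_mul]
      refine Finset.sum_le_sum fun k hk => (Finset.abs_sum_le_sum_abs _ _).trans ?_
      have h1 : ∀ r ∈ (Finset.univ : Finset (Fin k → Fin 3)),
          |c k r * ∏ i, h (r i)| ≤ S * (1 + ‖h‖) ^ (n + 1) := by
        intro r _
        rw [abs_mul]
        refine mul_le_mul (hcS k hk r) ((abs_prod_apply_le h r).trans ?_) (abs_nonneg _) hS0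
        calc ‖h‖ ^ k ≤ (1 + ‖h‖) ^ k := by gcongr; linarith
          _ ≤ _ := pow_le_pow_right₀ hw (by have := Finset.mem_range.1 hk; omega)
      refine (Finset.sum_le_card_nsmul _ _ _ h1).trans (le_of_eq ?_)
      simp
      ring
    have h2 : ‖η‖ ^ (n + 1) ≤ 2 ^ (n + 1) * (1 + ‖h‖) ^ (n + 1) := by
      rw [← mul_pow]
      gcongr
      linarith
    rw [le_div_iff₀ (by positivity)]
    have h3 : |b (η + h) - ∑ k ∈ Finset.range (n + 1), ∑ r, c k r * ∏ i, h (r i)| ≤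
        (B + Q * S) * (1 + ‖h‖) ^ (n + 1) := by
      refine (abs_sub _ _).trans ?_
      have h4 : B ≤ B * (1 + ‖h‖) ^ (n + 1) := le_mul_of_one_le_right hB0 (one_le_pow₀ hw)
      have := hB (η + h)
      linarith
    calc _ ≤ ((B + Q * S) * (1 + ‖h‖) ^ (n + 1)) * (2 ^ (n + 1) * (1 + ‖h‖) ^ (n + 1)) := by
          gcongr
      _ = ((B + Q * S) * 2 ^ (n + 1)) * (1 + ‖h‖) ^ (2 * (n + 1)) := by ring
      _ ≤ _ := by gcongr; rw [hC]; linarith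

/-! ### Fourier multipliers do not enlarge the singular support -/

theorem lineDeriv_apply (θ : Test) (m x : R3) : (∂_{m} θ : Test) x = fderiv ℝ θ x m := by
  rw [TestFunction.lineDerivOp_eq_lineDerivCLM ℝ, TestFunction.lineDerivCLM_apply_of_le (by simp),
    (θ.contDiff.differentiable (by simp) x).lineDeriv_eq_fderiv]

theorem toSchwartz_lineDeriv (θ : Test) (m : R3) :
    (∂_{m} θ : Test).toSchwartz = ∂_{m} θ.toSchwartz := by
  ext x
  have hd : DifferentiableAt ℝ θ x := θ.contDiff.differentiable (by simp) x
  rw [Test.toSchwartz_apply, lineDeriv_apply, SchwartzMap.lineDerivOp_apply_eq_fderiv]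
  have h : HasFDerivAt θ.toSchwartz (Complex.ofRealCLM.comp (fderiv ℝ θ x)) x :=
    Complex.ofRealCLM.hasFDerivAt.comp x hd.hasFDerivAt
  rw [h.fderiv]
  rfl

theorem tsupport_lineDeriv_subset (θ : Test) (m : R3) :
    tsupport (∂_{m} θ : Test) ⊆ tsupport θ := by
  rw [show ((∂_{m} θ : Test) : R3 → ℝ) = fun x => fderiv ℝ θ x m from
    funext fun x => lineDeriv_apply θ m x]
  exact tsupport_fderiv_apply_subset ℝ m

theorem fourierInv_lineDeriv (θ : Test) (m h : R3) :
    𝓕⁻ (∂_{m} θ : Test).toSchwartz h =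
      -(2 * Real.pi * Complex.I) * (inner ℝ h m : ℝ) * 𝓕⁻ θ.toSchwartz h := by
  have : (inner ℝ · m : R3 → ℝ).HasTemperateGrowth := by fun_prop
  rw [toSchwartz_lineDeriv, SchwartzMap.fourierInv_lineDerivOp_eq, smul_apply,
    smulLeftCLM_apply_apply this, smul_eq_mul, Complex.real_smul, ← mul_assoc]

theorem coord_mul_fourierInv (θ : Test) (j : Fin 3) (h : R3) :
    (h j : ℂ) * 𝓕⁻ θ.toSchwartz h =
      -(2 * Real.pi * Complex.I)⁻¹ * 𝓕⁻ (∂_{e j} θ : Test).toSchwartz h := by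
  have h1 : inner ℝ h (e j) = h j := by simp [e, EuclideanSpace.inner_single_right]
  have h2 : (2 * Real.pi * Complex.I : ℂ) ≠ 0 := Complex.two_pi_I_ne_zero
  rw [fourierInv_lineDeriv, h1]
  field_simp

theorem integrable_mul_schwartz (g : 𝓢(R3, ℂ)) {H : R3 → ℂ} (hH : AEStronglyMeasurable H volume)
    {A : ℝ} {K : ℕ} (hA : ∀ h, ‖H h‖ ≤ A * (1 + ‖h‖) ^ K) :
    Integrable fun h => H h * g h := by
  refine ((integrable_weight_mul g K).const_mul A).mono'
    (hH.mul g.continuous.aestronglyMeasurable) (Filter.Eventually.of_forall fun h => ?_)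
  rw [norm_mul, ← mul_assoc]
  exact mul_le_mul_of_nonneg_right (hA h) (norm_nonneg _)

/-- Multiplying by a monomial on the Fourier side differentiates the cut-off. -/
theorem rapidOn_monomial {ψ : Distr} {U : Set R3} (hU : IsOpen U) (hψ : IsSmoothOn ψ U)
    (θ₀ : Test) {k : ℕ} (r : Fin k → Fin 3) {θ : Test} (hθ : tsupport θ ⊆ U) :
    RapidOn (fun η => ∫ h, locFT ψ θ₀ (η + h) * (((∏ i, h (r i) : ℝ) : ℂ) * 𝓕⁻ θ.toSchwartz h))
      Set.univ := by
  induction k generalizing θ with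
  | zero =>
    have h1 := hψ.rapidOn hU ((tsupport_prodTest_subset_right θ₀ θ).trans hθ)
    intro N
    obtain ⟨C, hC⟩ := h1 N
    refine ⟨C, fun η hη => ?_⟩
    simpa [locFT_prodTest] using hC η hη
  | succ k ih =>
    have h1 := ih (fun i => r i.succ) ((tsupport_lineDeriv_subset θ (e (r 0))).trans hθ)
    intro N
    obtain ⟨C, hC⟩ := h1 N
    refine ⟨‖-(2 * Real.pi * Complex.I : ℂ)⁻¹‖ * C, fun η hη => ?_⟩
    have h2 : ∀ h : R3, locFT ψ θ₀ (η + h) *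
        (((∏ i, h (r i) : ℝ) : ℂ) * 𝓕⁻ θ.toSchwartz h) = -(2 * Real.pi * Complex.I : ℂ)⁻¹ *
          (locFT ψ θ₀ (η + h) * (((∏ i : Fin k, h (r i.succ) : ℝ) : ℂ) *
            𝓕⁻ (∂_{e (r 0)} θ : Test).toSchwartz h)) := by
      intro h
      rw [Fin.prod_univ_succ, Complex.ofReal_mul]
      linear_combination (locFT ψ θ₀ (η + h) * ((∏ i : Fin k, h (r i.succ) : ℝ) : ℂ)) *
        coord_mul_fourierInv θ (r 0) h
    simp_rw [h2]
    rw [integral_const_mul, norm_mul, mul_div_assoc]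
    exact mul_le_mul_of_nonneg_left (hC η hη) (norm_nonneg _)

/-- Where `ψ` is smooth, so is its image under a Fourier multiplier `b` that is homogeneous of
degree zero. The Taylor polynomial of `b` at `η` contributes derivatives of the cut-off, for which
`rapidOn_monomial` applies, and the remainder gains as many powers of `‖η‖` as desired. -/
theorem rapidOn_multiplier {ψ : Distr} {U : Set R3} (hU : IsOpen U) (hψ : IsSmoothOn ψ U)
    (θ₀ : Test) {θ : Test} (hθ : tsupport θ ⊆ U) {b : R3 → ℝ} (hb : ContDiffOn ℝ ∞ b {0}ᶜ)
    (hhom : ∀ t : ℝ, 0 < t → ∀ ξ, b (t • ξ) = b ξ) {B : ℝ} (hB : ∀ ξ, |b ξ| ≤ B) :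
    RapidOn (fun η => ∫ h, (b (η + h) * locFT ψ θ₀ (η + h)) * 𝓕⁻ θ.toSchwartz h) Set.univ := by
  set Ψ := locFT ψ θ₀ with hΨ
  set G := 𝓕⁻ θ.toSchwartz with hG
  have hB0 : 0 ≤ B := (abs_nonneg _).trans (hB 0)
  have hbm : Measurable b := measurable_of_continuousOn_compl_singleton 0 hb.continuousOn
  have hΨc : Continuous Ψ := continuous_locFT ψ θ₀
  obtain ⟨M, CΨ, hCΨ, hgr⟩ := exists_locFT_growth ψ θ₀
  have hgrow : ∀ η h : R3, ‖Ψ (η + h)‖ ≤ CΨ * (1 + ‖η‖) ^ M * (1 + ‖h‖) ^ M := by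
    intro η h
    refine (hgr _).trans ?_
    rw [mul_assoc, ← mul_pow]
    gcongr
    exact weight_add_le η h
  intro N
  -- The remainder of order `n + 1` has to compensate the growth of order `M` of `Ψ`.
  set n := N + M with hn
  obtain ⟨C, hC, htay⟩ := exists_taylor_homogeneous hb hhom hB n
  obtain ⟨C₁, hC₁, hI₁⟩ := exists_norm_integral_mul_le G (2 * (n + 1) + M)
  obtain ⟨C₂, hC₂, hI₂⟩ := exists_norm_integral_mul_le G M
  have hmono : ∀ k : ℕ, ∀ r : Fin k → Fin 3, ∃ D, 0 ≤ D ∧ ∀ η ∈ (Set.univ : Set R3),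
      ‖∫ h, Ψ (η + h) * (((∏ i, h (r i) : ℝ) : ℂ) * G h)‖ ≤ D / (1 + ‖η‖) ^ N := fun k r =>
    exists_nonneg_of_rapidOn (rapidOn_monomial hU hψ θ₀ r hθ) N
  choose D hD0 hD using hmono
  set T : ℝ := ∑ k ∈ Finset.range (n + 1), ∑ r : Fin k → Fin 3, C * D k r with hT
  have hT0 : 0 ≤ T := Finset.sum_nonneg fun k _ => Finset.sum_nonneg fun r _ =>
    mul_nonneg hC (hD0 k r)
  refine ⟨C₁ * (C * CΨ * 2 ^ (n + 1)) + T + C₂ * (B * CΨ * 2 ^ M) * 2 ^ N, fun η _ => ?_⟩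
  have hw := one_le_weight η
  by_cases hη : 1 ≤ ‖η‖
  · obtain ⟨c, hc, hrem⟩ := htay η hη
    set p : R3 → ℝ := fun h => ∑ k ∈ Finset.range (n + 1), ∑ r, c k r * ∏ i, h (r i) with hp
    have hpc : Continuous p := by rw [hp]; fun_prop
    set A : ℝ := C * CΨ * (1 + ‖η‖) ^ M / ‖η‖ ^ (n + 1) with hA
    have hbd : ∀ h, ‖((b (η + h) - p h : ℝ) : ℂ) * Ψ (η + h)‖ ≤
        A * (1 + ‖h‖) ^ (2 * (n + 1) + M) := by
      intro h
      rw [norm_mul, Complex.norm_real, Real.norm_eq_abs]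
      refine (mul_le_mul (hrem h) (hgrow η h) (norm_nonneg _) (by positivity)).trans (le_of_eq ?_)
      rw [hA]; ring
    have hi1 : Integrable fun h => (((b (η + h) - p h : ℝ) : ℂ) * Ψ (η + h)) * G h := by
      refine integrable_mul_schwartz G ?_ hbd
      refine AEStronglyMeasurable.mul ?_
        (hΨc.comp (continuous_const.add continuous_id)).aestronglyMeasurable
      exact (Complex.measurable_ofReal.comp ((hbm.comp (measurable_const_add η)).sub
        hpc.measurable)).aestronglyMeasurable
    have hi2 : ∀ k : ℕ, ∀ r : Fin k → Fin 3,
        Integrable fun h => Ψ (η + h) * (((∏ i, h (r i) : ℝ) : ℂ) * G h) := by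
      intro k r
      have : Integrable fun h => (Ψ (η + h) * ((∏ i, h (r i) : ℝ) : ℂ)) * G h := by
        refine integrable_mul_schwartz G (A := CΨ * (1 + ‖η‖) ^ M) (K := M + k)
          (Continuous.aestronglyMeasurable (by fun_prop)) fun h => ?_
        rw [norm_mul, Complex.norm_real, Real.norm_eq_abs, pow_add, ← mul_assoc]
        refine mul_le_mul (hgrow η h) ((abs_prod_apply_le h r).trans ?_) (abs_nonneg _)
          (by positivity)
        gcongr; linarith
      simpa only [mul_assoc] using this
    have hsplit : ∀ h, (b (η + h) * Ψ (η + h)) * G h =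
        (((b (η + h) - p h : ℝ) : ℂ) * Ψ (η + h)) * G h +
          ∑ k ∈ Finset.range (n + 1), ∑ r : Fin k → Fin 3,
            (c k r : ℂ) * (Ψ (η + h) * (((∏ i, h (r i) : ℝ) : ℂ) * G h)) := by
      intro h
      have : ∑ k ∈ Finset.range (n + 1), ∑ r : Fin k → Fin 3,
            (c k r : ℂ) * (Ψ (η + h) * (((∏ i, h (r i) : ℝ) : ℂ) * G h)) =
          (p h : ℂ) * (Ψ (η + h) * G h) := by
        simp only [hp, Complex.ofReal_sum, Finset.sum_mul]
        refine Finset.sum_congr rfl fun k _ => Finset.sum_congr rfl fun r _ => ?_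
        rw [Complex.ofReal_mul]; ring
      rw [this]; push_cast; ring
    simp only
    simp_rw [hsplit]
    rw [integral_add hi1 (integrable_finsetSum _ fun k _ => integrable_finsetSum _ fun r _ =>
        (hi2 k r).const_mul _), integral_finsetSum _ fun k _ => integrable_finsetSum _ fun r _ =>
        (hi2 k r).const_mul _]
    have hfirst : ‖∫ h, (((b (η + h) - p h : ℝ) : ℂ) * Ψ (η + h)) * G h‖ ≤
        C₁ * (C * CΨ * 2 ^ (n + 1)) / (1 + ‖η‖) ^ N := by
      refine (hI₁ _ A hbd).trans ?_
      rw [mul_div_assoc]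
      refine mul_le_mul_of_nonneg_left ?_ hC₁
      rw [hA, div_le_div_iff₀ (by positivity) (by positivity)]
      calc C * CΨ * (1 + ‖η‖) ^ M * (1 + ‖η‖) ^ N = C * CΨ * (1 + ‖η‖) ^ n := by
            rw [hn, pow_add]; ring
        _ ≤ C * CΨ * (1 + ‖η‖) ^ (n + 1) := by gcongr; omega
        _ ≤ C * CΨ * (2 * ‖η‖) ^ (n + 1) := by gcongr; linarith
        _ = _ := by rw [mul_pow]; ring
    have hsecond : ‖∑ k ∈ Finset.range (n + 1), ∫ h, ∑ r : Fin k → Fin 3,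
        (c k r : ℂ) * (Ψ (η + h) * (((∏ i, h (r i) : ℝ) : ℂ) * G h))‖ ≤ T / (1 + ‖η‖) ^ N := by
      rw [hT, Finset.sum_div]
      refine norm_sum_le_of_le _ fun k hk => ?_
      rw [integral_finsetSum _ fun r _ => (hi2 k r).const_mul _, Finset.sum_div]
      refine norm_sum_le_of_le _ fun r _ => ?_
      rw [integral_const_mul, norm_mul, Complex.norm_real, Real.norm_eq_abs, mul_div_assoc]
      exact mul_le_mul (hc k hk r) (hD k r η trivial) (norm_nonneg _) hC
    refine (norm_add_le _ _).trans ((add_le_add hfirst hsecond).trans ?_)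
    rw [← add_div]
    have : 0 ≤ C₂ * (B * CΨ * 2 ^ M) * 2 ^ N := by positivity
    exact div_le_div_of_nonneg_right (by linarith) (by positivity)
  · rw [not_le] at hη
    have h1 : ‖∫ h, (b (η + h) * Ψ (η + h)) * G h‖ ≤ C₂ * (B * CΨ * 2 ^ M) := by
      refine hI₂ _ _ fun h => ?_
      rw [norm_mul, Complex.norm_real, Real.norm_eq_abs]
      calc _ ≤ B * (CΨ * (1 + ‖η‖) ^ M * (1 + ‖h‖) ^ M) :=
            mul_le_mul (hB _) (hgrow η h) (norm_nonneg _) hB0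
        _ ≤ B * (CΨ * 2 ^ M * (1 + ‖h‖) ^ M) := by gcongr; linarith
        _ = _ := by ring
    rw [le_div_iff₀ (by positivity)]
    have h2 : (1 + ‖η‖) ^ N ≤ 2 ^ N := by gcongr; linarith
    have h3 : 0 ≤ C₁ * (C * CΨ * 2 ^ (n + 1)) := by positivity
    have h4 : C₂ * (B * CΨ * 2 ^ M) ≥ 0 := by positivity
    calc _ ≤ C₂ * (B * CΨ * 2 ^ M) * 2 ^ N := mul_le_mul h1 h2 (by positivity) h4
      _ ≤ _ := by linarith

/-! ### The characteristic cone -/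

theorem norm_sq_eq (ξ : R3) : ‖ξ‖ ^ 2 = ξ 0 ^ 2 + ξ 1 ^ 2 + ξ 2 ^ 2 := by
  rw [EuclideanSpace.norm_sq_eq, Fin.sum_univ_three]
  simp

theorem symbol_eq (ξ : R3) : symbol ξ = -(2 / 3) * ξ 2 ^ 2 + 1 / 3 * (ξ 0 ^ 2 + ξ 1 ^ 2) := by
  rw [symbol, norm_sq_eq]; ring

/-- The characteristic cone is a null set, as it meets each vertical line in at most two points. -/
theorem ae_symbol_ne_zero : ∀ᵐ ξ : R3, symbol ξ ≠ 0 := by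
  let Z : Set (ℝ × (Fin 2 → ℝ)) := {q | -(2 / 3) * q.1 ^ 2 + 1 / 3 * (q.2 0 ^ 2 + q.2 1 ^ 2) = 0}
  have hZ : MeasurableSet Z := (isClosed_eq (by fun_prop) continuous_const).measurableSet
  have hZ0 : volume Z = 0 := by
    rw [Measure.volume_eq_prod, Measure.prod_apply_symm hZ, lintegral_eq_zero_of_ae_eq_zero]
    refine Filter.Eventually.of_forall fun y => ?_
    set c := √((y 0 ^ 2 + y 1 ^ 2) / 2) with hc
    have hc2 : c ^ 2 = (y 0 ^ 2 + y 1 ^ 2) / 2 := Real.sq_sqrt (by positivity)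
    refine measure_mono_null (t := {c, -c}) (fun t ht => ?_) (Set.Finite.measure_zero (by simp) _)
    have ht' : -(2 / 3) * t ^ 2 + 1 / 3 * (y 0 ^ 2 + y 1 ^ 2) = 0 := ht
    exact sq_eq_sq_iff_eq_or_eq_neg.1 (by linarith)
  have h1 := (volume_preserving_piFinSuccAbove (fun _ : Fin 3 => ℝ) 2).comp
    (PiLp.volume_preserving_ofLp (Fin 3))
  have h2 := h1.measure_preimage hZ.nullMeasurableSet
  rw [hZ0] at h2
  refine measure_mono_null (fun ξ hξ => ?_) h2
  simp only [Set.mem_compl_iff, Set.mem_ofPred_eq, not_not] at hξ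
  rw [symbol_eq] at hξ
  exact hξ

/-- The radius `|ξ'| / √2` of the cone `p = 0` above `ξ' = (ξ₁, ξ₂)`, so that
`p(ξ) = -(2/3) (ξ₃² - (|ξ'| / √2)²)`. -/
noncomputable def coneHeight (ξ : R3) : ℝ := √((ξ 0 ^ 2 + ξ 1 ^ 2) / 2)

/-- The signed distance, in the third coordinate, from `ξ` to the sheet of the cone `p = 0` lying in
the same half space; the upper sheet is chosen if `ξ₃ = 0`. -/
noncomputable def coneShift (ξ : R3) : ℝ :=
  if 0 ≤ ξ 2 then coneHeight ξ - ξ 2 else -coneHeight ξ - ξ 2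

/-- The vertical projection of `ξ` to the cone `p = 0`, in the half space of `ξ`. -/
noncomputable def coneProj (ξ : R3) : R3 := ξ + coneShift ξ • e 2

theorem coneHeight_nonneg (ξ : R3) : 0 ≤ coneHeight ξ := Real.sqrt_nonneg _

theorem coneHeight_sq (ξ : R3) : coneHeight ξ ^ 2 = (ξ 0 ^ 2 + ξ 1 ^ 2) / 2 :=
  Real.sq_sqrt (by positivity)

theorem measurable_coneProj : Measurable coneProj := by
  have hc : Continuous coneHeight := by unfold coneHeight; fun_prop
  have h2 : Continuous fun ξ : R3 => ξ 2 := by fun_prop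
  have h : Measurable coneShift := Measurable.ite
    (isClosed_le continuous_const h2).measurableSet
    (hc.sub h2).measurable (hc.neg.sub h2).measurable
  exact measurable_id.add (h.smul_const _)

theorem symbol_coneProj (ξ : R3) : symbol (coneProj ξ) = 0 := by
  have h := coneHeight_sq ξ
  have h0 : coneProj ξ 0 = ξ 0 := by simp [coneProj, e]
  have h1 : coneProj ξ 1 = ξ 1 := by simp [coneProj, e]
  have h2 : coneProj ξ 2 = ξ 2 + coneShift ξ := by simp [coneProj, e]
  rw [symbol_eq, h0, h1, h2, coneShift]
  split_ifs <;> ring_nf <;> linarith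

theorem abs_symbol_eq (ξ : R3) :
    |symbol ξ| = 2 / 3 * |coneShift ξ| * (|ξ 2| + coneHeight ξ) := by
  have h := coneHeight_sq ξ
  have hc := coneHeight_nonneg ξ
  have h1 : |symbol ξ| = |2 / 3 * coneShift ξ * (|ξ 2| + coneHeight ξ)| := by
    rw [symbol_eq, coneShift]
    split_ifs with h3
    · rw [abs_of_nonneg h3]
      congr 1; linear_combination (-2 / 3) * h
    · rw [abs_of_neg (not_le.1 h3), ← abs_neg]
      congr 1; linear_combination (2 / 3) * h
  rw [h1, abs_mul, abs_mul, abs_of_nonneg (show 0 ≤ |ξ 2| + coneHeight ξ by positivity)]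
  norm_num

theorem norm_le_two_mul_height (ξ : R3) : ‖ξ‖ ≤ 2 * (|ξ 2| + coneHeight ξ) := by
  have hc := coneHeight_nonneg ξ
  refine abs_le_of_sq_le_sq' ?_ (by positivity) |>.2
  rw [norm_sq_eq]
  nlinarith [coneHeight_sq ξ, sq_abs (ξ 2), abs_nonneg (ξ 2), mul_nonneg (abs_nonneg (ξ 2)) hc]

theorem abs_coneShift_le (ξ : R3) : |coneShift ξ| ≤ ‖ξ‖ := by
  have hc := coneHeight_nonneg ξ
  have h1 : coneHeight ξ ≤ ‖ξ‖ := by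
    refine abs_le_of_sq_le_sq' ?_ (norm_nonneg _) |>.2
    rw [norm_sq_eq, coneHeight_sq]
    nlinarith [sq_nonneg (ξ 0), sq_nonneg (ξ 1), sq_nonneg (ξ 2)]
  have h2 := abs_le.1 (abs_apply_le_norm ξ 2)
  rw [coneShift, abs_le]
  split_ifs with h <;> constructor <;> linarith

theorem norm_coneProj_sub (ξ : R3) : ‖coneProj ξ - ξ‖ = |coneShift ξ| := by
  rw [coneProj, add_sub_cancel_left, norm_smul, norm_e, mul_one, Real.norm_eq_abs]

theorem norm_coneProj_le (ξ : R3) : ‖coneProj ξ‖ ≤ 2 * ‖ξ‖ := by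
  have h := norm_add_le ξ (coneProj ξ - ξ)
  rw [add_sub_cancel, norm_coneProj_sub] at h
  linarith [abs_coneShift_le ξ]

/-- The difference quotient that divides `g` by the symbol after subtracting its values on the
cone. Where the symbol vanishes it is `0` by the convention for division; this is a null set. -/
noncomputable def coneQuot (g : R3 → ℂ) (ξ : R3) : ℂ := (g ξ - g (coneProj ξ)) / symbol ξ

/-- By the mean value inequality the numerator of `coneQuot g ξ` is bounded by the distance of `ξ` to
its projection, which is a factor of the symbol. The other factor is at least of the order of
`‖ξ‖`. -/
theorem norm_coneQuot_le {g : R3 → ℂ} (hg : Differentiable ℝ g) {ξ : R3} {D : ℝ}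
    (hD : ∀ ζ : R3, ‖ζ‖ ≤ 2 * ‖ξ‖ → ‖fderiv ℝ g ζ‖ ≤ D) :
    ‖(‖ξ‖ ^ 2 : ℂ) * coneQuot g ξ‖ ≤ 3 * ‖ξ‖ * D := by
  have hD0 : 0 ≤ D := (norm_nonneg _).trans (hD ξ (by linarith [norm_nonneg ξ]))
  by_cases hs : symbol ξ = 0
  · simp only [coneQuot, hs, Complex.ofReal_zero, div_zero, mul_zero, norm_zero]
    positivity
  · have h1 : ‖g ξ - g (coneProj ξ)‖ ≤ D * |coneShift ξ| := by
      rw [← norm_coneProj_sub, norm_sub_rev (coneProj ξ)]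
      refine (convex_closedBall (0 : R3) (2 * ‖ξ‖)).norm_image_sub_le_of_norm_fderiv_le (𝕜 := ℝ)
        (fun x _ => hg x) (fun x hx => hD x (by simpa using hx)) ?_ ?_
      · simpa using norm_coneProj_le ξ
      · simp only [mem_closedBall_zero_iff]; linarith [norm_nonneg ξ]
    have hpos : 0 < |symbol ξ| := abs_pos.2 hs
    rw [coneQuot, norm_mul, norm_div, Complex.norm_real, Real.norm_eq_abs, norm_pow,
      Complex.norm_real, norm_norm, ← mul_div_assoc, div_le_iff₀ hpos]
    have h2 : ‖ξ‖ ^ 2 * ‖g ξ - g (coneProj ξ)‖ ≤ ‖ξ‖ ^ 2 * (D * |coneShift ξ|) := by gcongr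
    refine h2.trans ?_
    rw [abs_symbol_eq]
    have h3 := norm_le_two_mul_height ξ
    calc ‖ξ‖ ^ 2 * (D * |coneShift ξ|) = ‖ξ‖ * D * |coneShift ξ| * ‖ξ‖ := by ring
      _ ≤ ‖ξ‖ * D * |coneShift ξ| * (2 * (|ξ 2| + coneHeight ξ)) := by gcongr
      _ = _ := by ring

/-! ### Distributions defined by integrals on the Fourier side -/

theorem seminorm_sup_bound (g : 𝓢(R3, ℂ)) (K : ℕ) (x : R3) :
    (1 + ‖x‖) ^ K * ‖g x‖ ≤
      2 ^ K * (Finset.Iic (K, 0)).sup (schwartzSeminormFamily ℂ R3 ℂ) g := by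
  have := SchwartzMap.one_add_le_sup_seminorm_apply (𝕜 := ℂ) (m := (K, 0)) le_rfl le_rfl g x
  rwa [norm_iteratedFDeriv_zero] at this

theorem norm_fderiv_le_seminorm (g : 𝓢(R3, ℂ)) (x : R3) :
    ‖fderiv ℝ g x‖ ≤ ({(0, 1)} : Finset (ℕ × ℕ)).sup (schwartzSeminormFamily ℂ R3 ℂ) g := by
  have := SchwartzMap.le_seminorm ℂ 0 1 g x
  rw [pow_zero, one_mul, norm_iteratedFDeriv_one] at this
  simpa using this

theorem exists_fderiv_decay (g : 𝓢(R3, ℂ)) (K : ℕ) :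
    ∃ C, 0 ≤ C ∧ ∀ x, ‖fderiv ℝ g x‖ ≤ C / (1 + ‖x‖) ^ K := by
  refine ⟨2 ^ K * (Finset.Iic (K, 1)).sup (schwartzSeminormFamily ℂ R3 ℂ) g, by positivity,
    fun x => ?_⟩
  have h1 := one_le_weight x
  have := SchwartzMap.one_add_le_sup_seminorm_apply (𝕜 := ℂ) (m := (K, 1)) le_rfl le_rfl g x
  rw [norm_iteratedFDeriv_one] at this
  rw [le_div_iff₀ (by positivity), mul_comm]
  exact this

/-- The functional with a density of polynomial growth on the Fourier side. -/
theorem exists_functional_of_growth {F : R3 → ℂ} (hF : AEStronglyMeasurable F volume) {M : ℕ}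
    {C : ℝ} (hC : 0 ≤ C) (hgr : ∀ ξ, ‖F ξ‖ ≤ C * (1 + ‖ξ‖) ^ M) :
    ∃ A : 𝓢(R3, ℂ) →L[ℂ] ℂ, ∀ S, A S = ∫ ξ, F ξ * 𝓕⁻ S ξ := by
  have hi : ∀ g : 𝓢(R3, ℂ), Integrable fun ξ => F ξ * g ξ := fun g =>
    integrable_mul_schwartz g hF hgr
  have hI : 0 ≤ ∫ x : R3, 1 / (1 + ‖x‖) ^ 4 := integral_nonneg fun x => by positivity
  let A₀ : 𝓢(R3, ℂ) →L[ℂ] ℂ := SchwartzMap.mkCLMtoNormedSpace (𝕜 := ℂ) (σ := RingHom.id ℂ)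
    (fun g => ∫ ξ, F ξ * g ξ)
    (fun f g => by
      rw [← integral_add (hi f) (hi g)]
      simp only [add_apply, mul_add])
    (fun a f => by
      rw [RingHom.id_apply, smul_eq_mul, ← integral_const_mul]
      congr 1; ext ξ
      simp only [smul_apply, smul_eq_mul]; ring)
    ⟨Finset.Iic (M + 4, 0), C * (2 ^ (M + 4) * ∫ x : R3, 1 / (1 + ‖x‖) ^ 4), by positivity, by
      intro g
      set s := (Finset.Iic (M + 4, 0)).sup (schwartzSeminormFamily ℂ R3 ℂ) g with hs
      have hs0 : 0 ≤ s := apply_nonneg _ _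
      refine (norm_integral_le_of_norm_le
        (integrable_weight_inv.const_mul (C * (2 ^ (M + 4) * s)))
        (Filter.Eventually.of_forall fun ξ => ?_)).trans (le_of_eq ?_)
      · have h1 := one_le_weight ξ
        have h2 := seminorm_sup_bound g (M + 4) ξ
        rw [norm_mul, mul_one_div, le_div_iff₀ (by positivity)]
        calc ‖F ξ‖ * ‖g ξ‖ * (1 + ‖ξ‖) ^ 4 ≤ (C * (1 + ‖ξ‖) ^ M) * ‖g ξ‖ * (1 + ‖ξ‖) ^ 4 := by
              gcongr; exact hgr ξ
          _ = C * ((1 + ‖ξ‖) ^ (M + 4) * ‖g ξ‖) := by rw [pow_add]; ring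
          _ ≤ _ := by gcongr
      · rw [integral_const_mul]; ring⟩
  exact ⟨A₀.comp (fourierInvCLM ℂ 𝓢(R3, ℂ)), fun S => rfl⟩

/-- Integration against a rapidly decreasing function is bounded with respect to the weighted sup
norms. -/
theorem RapidOn.integral_mul_le {F : R3 → ℂ} (hF : AEStronglyMeasurable F volume)
    (hr : RapidOn F Set.univ) (K : ℕ) :
    ∃ C, 0 ≤ C ∧ ∀ (H : R3 → ℂ) (A : ℝ), AEStronglyMeasurable H volume →
      (∀ ξ, ‖H ξ‖ ≤ A * (1 + ‖ξ‖) ^ K) →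
      Integrable (fun ξ => F ξ * H ξ) ∧ ‖∫ ξ, F ξ * H ξ‖ ≤ C * A := by
  obtain ⟨C, hC0, hC⟩ := exists_nonneg_of_rapidOn hr (K + 4)
  refine ⟨C * ∫ x : R3, 1 / (1 + ‖x‖) ^ 4,
    mul_nonneg hC0 (integral_nonneg fun x => by positivity), fun H A hH hA => ?_⟩
  have hb : ∀ ξ, ‖F ξ * H ξ‖ ≤ C * A * (1 / (1 + ‖ξ‖) ^ 4) := fun ξ => by
    have h1 := one_le_weight ξ
    rw [norm_mul]
    refine (mul_le_mul (hC ξ trivial) (hA ξ) (norm_nonneg _) (by positivity)).trans (le_of_eq ?_)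
    rw [pow_add]; field_simp
  refine ⟨(integrable_weight_inv.const_mul _).mono' (hF.mul hH) (Filter.Eventually.of_forall hb),
    (norm_integral_le_of_norm_le (integrable_weight_inv.const_mul _)
      (Filter.Eventually.of_forall hb)).trans (le_of_eq ?_)⟩
  rw [integral_const_mul]; ring

theorem measurable_coneQuot {g : R3 → ℂ} (hg : Continuous g) : Measurable (coneQuot g) :=
  (hg.measurable.sub (hg.measurable.comp measurable_coneProj)).div
    (Complex.measurable_ofReal.comp continuous_symbol.measurable)

theorem aestronglyMeasurable_coneQuot (g : 𝓢(R3, ℂ)) :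
    AEStronglyMeasurable (fun ξ : R3 => (‖ξ‖ ^ 2 : ℂ) * coneQuot g ξ) volume :=
  ((by fun_prop : Measurable fun ξ : R3 => (‖ξ‖ ^ 2 : ℂ)).mul
    (measurable_coneQuot g.continuous)).aestronglyMeasurable

/-- If `F` decays rapidly, then division by the symbol after subtraction of the values on the cone
defines a distribution all of whose localized Fourier transforms decay rapidly. Modulation by `η`
translates `𝓕⁻ θ` by `η`, and the quotient at `ξ` involves its derivatives only at points
`ζ - η` with `‖ζ‖ ≤ 2 ‖ξ‖`; powers of `1 + ‖ξ‖` are absorbed by `F`. -/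
theorem exists_smooth_division {F : R3 → ℂ} (hF : AEStronglyMeasurable F volume)
    (hr : RapidOn F Set.univ) :
    ∃ A : 𝓢(R3, ℂ) →L[ℂ] ℂ,
      (∀ S, A S = ∫ ξ, F ξ * ((‖ξ‖ ^ 2 : ℂ) * coneQuot (𝓕⁻ S : 𝓢(R3, ℂ)) ξ)) ∧
      ∀ θ : Test, RapidOn (locFT (ofSchwartz A) θ) Set.univ := by
  obtain ⟨C, hC0, hC⟩ := hr.integral_mul_le hF 1
  have hb : ∀ (g : 𝓢(R3, ℂ)) (ξ : R3), ‖(‖ξ‖ ^ 2 : ℂ) * coneQuot g ξ‖ ≤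
      3 * (({(0, 1)} : Finset (ℕ × ℕ)).sup (schwartzSeminormFamily ℂ R3 ℂ) g) *
        (1 + ‖ξ‖) ^ 1 := fun g ξ => by
    refine (norm_coneQuot_le g.differentiable fun ζ _ => norm_fderiv_le_seminorm g ζ).trans ?_
    have h0 : 0 ≤ ({(0, 1)} : Finset (ℕ × ℕ)).sup (schwartzSeminormFamily ℂ R3 ℂ) g :=
      apply_nonneg _ _
    rw [pow_one]
    nlinarith [norm_nonneg ξ]
  have hi : ∀ g : 𝓢(R3, ℂ), Integrable fun ξ : R3 => F ξ * ((‖ξ‖ ^ 2 : ℂ) * coneQuot g ξ) :=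
    fun g => (hC _ _ (aestronglyMeasurable_coneQuot g) (hb g)).1
  let A₀ : 𝓢(R3, ℂ) →L[ℂ] ℂ := SchwartzMap.mkCLMtoNormedSpace (𝕜 := ℂ) (σ := RingHom.id ℂ)
    (fun g => ∫ ξ : R3, F ξ * ((‖ξ‖ ^ 2 : ℂ) * coneQuot g ξ))
    (fun f g => by
      rw [← integral_add (hi f) (hi g)]
      congr 1; ext ξ
      simp only [coneQuot, add_apply]; ring)
    (fun a f => by
      rw [RingHom.id_apply, smul_eq_mul, ← integral_const_mul]
      congr 1; ext ξ
      simp only [coneQuot, smul_apply, smul_eq_mul]; ring)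
    ⟨{(0, 1)}, C * 3, by positivity, fun g =>
      ((hC _ _ (aestronglyMeasurable_coneQuot g) (hb g)).2).trans (le_of_eq (by ring))⟩
  refine ⟨A₀.comp (fourierInvCLM ℂ 𝓢(R3, ℂ)), fun S => rfl, fun θ N => ?_⟩
  obtain ⟨C', hC'0, hC'⟩ := hr.integral_mul_le hF (N + 1)
  obtain ⟨D, hD0, hD⟩ := exists_fderiv_decay (𝓕⁻ θ.toSchwartz) N
  refine ⟨C' * (3 * D * 2 ^ N), fun η _ => ?_⟩
  have hw := one_le_weight η
  rw [locFT_ofSchwartz]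
  refine ((hC' _ (3 * D * 2 ^ N / (1 + ‖η‖) ^ N)
    (aestronglyMeasurable_coneQuot (𝓕⁻ (modulate θ η))) fun ξ => ?_).2).trans (le_of_eq (by ring))
  have hcoe : ((𝓕⁻ (modulate θ η) : 𝓢(R3, ℂ)) : R3 → ℂ) =
      fun ξ => 𝓕⁻ θ.toSchwartz (ξ - η) := funext fun ξ => fourierInv_modulate θ η ξ
  have hw' := one_le_weight ξ
  refine (norm_coneQuot_le (SchwartzMap.differentiable _)
    (D := D * (2 ^ N * (1 + ‖ξ‖) ^ N / (1 + ‖η‖) ^ N)) fun ζ hζ => ?_).trans ?_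
  · have hd : fderiv ℝ (𝓕⁻ (modulate θ η) : 𝓢(R3, ℂ)) ζ =
        fderiv ℝ (𝓕⁻ θ.toSchwartz : 𝓢(R3, ℂ)) (ζ - η) := by
      rw [hcoe]
      exact fderiv_comp_sub η
    rw [hd]
    refine (hD _).trans ?_
    rw [div_eq_mul_one_div]
    refine mul_le_mul_of_nonneg_left ?_ hD0
    rw [norm_sub_rev]
    have := inv_weight_sub_le η ζ N
    refine this.trans (div_le_div_of_nonneg_right ?_ (by positivity))
    rw [← mul_pow]
    gcongr
    linarith [norm_nonneg ξ]
  · calc 3 * ‖ξ‖ * (D * (2 ^ N * (1 + ‖ξ‖) ^ N / (1 + ‖η‖) ^ N)) =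
        3 * D * 2 ^ N / (1 + ‖η‖) ^ N * ((1 + ‖ξ‖) ^ N * ‖ξ‖) := by ring
      _ ≤ 3 * D * 2 ^ N / (1 + ‖η‖) ^ N * ((1 + ‖ξ‖) ^ N * (1 + ‖ξ‖)) := by
        gcongr; linarith
      _ = _ := by rw [pow_succ]

/-! ### Splitting the inverse of the symbol -/

/-- A cut-off `κ` to a conic neighbourhood of the characteristic cone, and a multiplier `b`,
homogeneous of degree zero, that inverts `p(ξ) / ‖ξ‖ ^ 2` up to `κ`. -/
theorem exists_conic_parametrix {ε : ℝ} (hε : 0 < ε) :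
    ∃ κ b : R3 → ℝ, Measurable κ ∧ (∀ ξ, |κ ξ| ≤ 1) ∧
      (∀ ξ, ξ ≠ 0 → κ ξ ≠ 0 → |symbol ξ| < ε * ‖ξ‖ ^ 2) ∧
      ContDiffOn ℝ ∞ b {0}ᶜ ∧ (∀ t : ℝ, 0 < t → ∀ ξ, b (t • ξ) = b ξ) ∧
      (∃ B, ∀ ξ, |b ξ| ≤ B) ∧ ∀ ξ, b ξ * symbol ξ = (1 - κ ξ) * ‖ξ‖ ^ 2 := by
  -- Both `κ` and `b` are functions of `s = p(ξ) / ‖ξ‖²`: `κ = ρ(s)` and `b = (1 - ρ(s)) / s`.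
  let ρ : ContDiffBump (0 : ℝ) := ⟨ε / 2, ε, by positivity, by linarith⟩
  let s : R3 → ℝ := fun ξ => symbol ξ / ‖ξ‖ ^ 2
  let q : ℝ → ℝ := fun t => (1 - ρ t) / t
  have hρ1 : ∀ t : ℝ, |t| ≤ ε / 2 → ρ t = 1 := fun t ht =>
    ρ.one_of_mem_closedBall (by simpa using ht)
  have hq0 : ∀ t : ℝ, |t| ≤ ε / 2 → q t = 0 := fun t ht => by simp [q, hρ1 t ht]
  have hs : ContDiffOn ℝ ∞ s {0}ᶜ := by
    intro ξ hξ
    have hξ' : ‖ξ‖ ^ 2 ≠ 0 := by simpa using hξ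
    refine ContDiffAt.contDiffWithinAt ?_
    have h1 : ContDiff ℝ ∞ fun ξ : R3 => ‖ξ‖ ^ 2 := contDiff_norm_sq ℝ
    have h2 : ContDiff ℝ ∞ symbol := by
      unfold symbol
      have : ContDiff ℝ ∞ fun ξ : R3 => ξ 2 := by fun_prop
      exact (this.pow 2).neg.add (contDiff_const.mul h1)
    exact h2.contDiffAt.div h1.contDiffAt hξ'
  have hq : ContDiff ℝ ∞ q := by
    rw [contDiff_iff_contDiffAt]
    intro t
    by_cases ht : t = 0
    · subst ht
      have : q =ᶠ[nhds 0] fun _ => 0 := by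
        filter_upwards [Metric.ball_mem_nhds (0 : ℝ) (half_pos hε)] with t ht
        exact hq0 t (by simpa using (mem_ball_zero_iff.1 ht).le)
      exact contDiffAt_const.congr_of_eventuallyEq this
    · exact (contDiffAt_const.sub ρ.contDiffAt).div contDiffAt_id ht
  have hshom : ∀ t : ℝ, 0 < t → ∀ ξ, s (t • ξ) = s ξ := fun t ht ξ => by
    simp only [s, symbol_smul, norm_smul, mul_pow, Real.norm_eq_abs, sq_abs]
    exact mul_div_mul_left _ _ (by positivity)
  have hsm : Measurable s := continuous_symbol.measurable.div (by fun_prop)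
  have hρ01 : ∀ t, 0 ≤ ρ t ∧ ρ t ≤ 1 := fun t => ⟨ρ.nonneg, ρ.le_one⟩
  refine ⟨fun ξ => ρ (s ξ), fun ξ => q (s ξ), ρ.continuous.measurable.comp hsm, fun ξ => ?_,
    fun ξ hξ hκ => ?_, hq.comp_contDiffOn hs, fun t ht ξ => by simp only [hshom t ht ξ],
    ⟨2 / ε, fun ξ => ?_⟩, fun ξ => ?_⟩
  · exact abs_le.2 ⟨by linarith [(hρ01 (s ξ)).1], (hρ01 (s ξ)).2⟩
  · have h1 : s ξ ∈ Metric.ball (0 : ℝ) ε := by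
      have h2 : s ξ ∈ Function.support ρ := hκ
      rwa [ρ.support_eq] at h2
    have hξ' : 0 < ‖ξ‖ ^ 2 := by have := norm_pos_iff.2 hξ; positivity
    simp only [mem_ball_zero_iff, s, Real.norm_eq_abs, abs_div] at h1
    rwa [abs_of_pos hξ', div_lt_iff₀ hξ'] at h1
  · by_cases ht : |s ξ| ≤ ε / 2
    · simp only [hq0 _ ht, abs_zero]; positivity
    · rw [not_le] at ht
      have h1 : |1 - ρ (s ξ)| ≤ 1 :=
        abs_le.2 ⟨by linarith [(hρ01 (s ξ)).2], by linarith [(hρ01 (s ξ)).1]⟩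
      have h2 : 0 < |s ξ| := by linarith
      simp only [q]
      rw [abs_div, div_le_div_iff₀ h2 hε]
      nlinarith
  · by_cases hξ : ξ = 0
    · subst hξ; simp [symbol]
    · have hξ' : ‖ξ‖ ^ 2 ≠ 0 := by simpa using hξ
      by_cases h0 : symbol ξ = 0
      · have : s ξ = 0 := by simp [s, h0]
        simp [h0, this, hρ1 0 (by simp; positivity)]
      · simp only [q, s]
        field_simp

theorem fourierInv_lineDeriv_lineDeriv (φ : Test) (i : Fin 3) (ξ : R3) :
    𝓕⁻ (∂_{e i} (∂_{e i} φ) : Test).toSchwartz ξ =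
      -((2 * Real.pi) ^ 2 * ξ i ^ 2 : ℝ) * 𝓕⁻ φ.toSchwartz ξ := by
  have h1 : inner ℝ ξ (e i) = ξ i := by simp [e, EuclideanSpace.inner_single_right]
  rw [fourierInv_lineDeriv, fourierInv_lineDeriv, h1]
  push_cast
  linear_combination (4 * (Real.pi : ℂ) ^ 2 * (ξ i : ℂ) ^ 2 * 𝓕⁻ φ.toSchwartz ξ) * Complex.I_sq

/-- Evaluation of the inverse Fourier transform of a test function, as a linear functional. -/
noncomputable def fourierInvEval (ξ : R3) : Test →ₗ[ℝ] ℂ where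
  toFun φ := 𝓕⁻ φ.toSchwartz ξ
  map_add' φ₁ φ₂ := by
    rw [← toSchwartzCLM_apply, map_add, FourierInvAdd.fourierInv_add]
    rfl
  map_smul' c φ := by
    have h : toSchwartzCLM (c • φ) = (c : ℂ) • toSchwartzCLM φ := by
      rw [map_smul]; ext x; simp
    rw [← toSchwartzCLM_apply, h, FourierInvSMul.fourierInv_smul]
    simp [toSchwartzCLM_apply]

theorem fourierInvEval_apply (ξ : R3) (φ : Test) :
    fourierInvEval ξ φ = 𝓕⁻ φ.toSchwartz ξ := rfl

/-- The Laplacian on test functions. -/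
noncomputable def laplacianTest (φ : Test) : Test := ∑ i : Fin 3, ∂_{e i} (∂_{e i} φ)

/-- The operator `P(∂)` on test functions. -/
noncomputable def waveTest (φ : Test) : Test :=
  (2 / 3 : ℝ) • ∂_{e 2} (∂_{e 2} φ) - (1 / 3 : ℝ) • (∂_{e 0} (∂_{e 0} φ) + ∂_{e 1} (∂_{e 1} φ))

theorem lineDeriv_lineDeriv_apply (u : Distr) (m : R3) (φ : Test) :
    (∂_{m} (∂_{m} u) : Distr) φ = u (∂_{m} (∂_{m} φ)) := by
  rw [Distribution.lineDerivOp_apply_apply, Distribution.lineDerivOp_apply_apply,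
    LineDeriv.lineDerivOp_neg, neg_neg]

theorem laplacian_apply (u : Distr) (φ : Test) : laplacian u φ = u (laplacianTest φ) := by
  rw [laplacian, laplacianTest, Fin.sum_univ_three, Fin.sum_univ_three, map_add, map_add,
    ← lineDeriv_lineDeriv_apply, ← lineDeriv_lineDeriv_apply, ← lineDeriv_lineDeriv_apply]
  rfl

theorem waveOp_apply (u : Distr) (φ : Test) : waveOp u φ = u (waveTest φ) := by
  rw [waveOp, waveTest, map_sub, map_smul, map_smul, map_add, ← lineDeriv_lineDeriv_apply,
    ← lineDeriv_lineDeriv_apply, ← lineDeriv_lineDeriv_apply]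
  rfl

theorem fourierInv_laplacianTest (φ : Test) (ξ : R3) :
    𝓕⁻ (laplacianTest φ).toSchwartz ξ =
      -((2 * Real.pi) ^ 2 * ‖ξ‖ ^ 2 : ℝ) * 𝓕⁻ φ.toSchwartz ξ := by
  rw [← fourierInvEval_apply, laplacianTest, map_sum, Fin.sum_univ_three]
  simp only [fourierInvEval_apply, fourierInv_lineDeriv_lineDeriv]
  rw [norm_sq_eq]
  push_cast; ring

theorem fourierInv_waveTest (φ : Test) (ξ : R3) :
    𝓕⁻ (waveTest φ).toSchwartz ξ =
      ((2 * Real.pi) ^ 2 * symbol ξ : ℝ) * 𝓕⁻ φ.toSchwartz ξ := by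
  rw [← fourierInvEval_apply, waveTest, map_sub, map_smul, map_smul, map_add]
  simp only [fourierInvEval_apply, fourierInv_lineDeriv_lineDeriv, Complex.real_smul]
  rw [symbol_eq]
  push_cast; ring

theorem add_locFT (u v : Distr) (θ : Test) (ξ : R3) :
    locFT (u + v) θ ξ = locFT u θ ξ + locFT v θ ξ := by
  have h : ∀ φ : Test, (u + v) φ = u φ + v φ := fun φ => rfl
  simp only [locFT, localFourier, h]
  ring

/-! ### The solution -/

/-- The two parts of the solution are `ofSchwartz A₁`, given by the division near the cone, and
`ofSchwartz A₂`, given by the multiplier away from the cone. -/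
theorem exists_waveOp_eq (ψ : Distr) (hψ : IsCompact (Distribution.dsupport ψ))
    (hWF : WF ψ ∩ charSet = ∅) :
    ∃ χ : Distr, waveOp χ = -laplacian ψ ∧ singsupp χ ⊆ singsupp ψ := by
  obtain ⟨θ₀, -, -, W, hW, hψW, hθ₀⟩ := exists_test_eq_one hψ isOpen_univ (Set.subset_univ _)
  set Ψ := locFT ψ θ₀ with hΨ
  have hΨc : Continuous Ψ := continuous_locFT ψ θ₀
  have hrep : ∀ φ : Test, ψ φ = ∫ ξ, Ψ ξ * 𝓕⁻ φ.toSchwartz ξ := fun φ => by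
    rw [← apply_prodTest_of_eq_one ψ θ₀ hW hψW hθ₀, apply_prodTest_eq_integral]
  obtain ⟨ε, hε, hΨr⟩ := exists_rapidOn_near_cone ψ θ₀ hWF
  obtain ⟨κ, b, hκm, hκ1, hκs, hb, hbhom, ⟨B, hB⟩, hbκ⟩ := exists_conic_parametrix hε
  have hbm : Measurable b := measurable_of_continuousOn_compl_singleton 0 hb.continuousOn
  obtain ⟨M, C, hC, hgr⟩ := exists_locFT_growth ψ θ₀
  have hB0 : 0 ≤ B := (abs_nonneg _).trans (hB 0)
  have hκΨm : AEStronglyMeasurable (fun ξ => (κ ξ : ℂ) * Ψ ξ) volume :=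
    ((Complex.measurable_ofReal.comp hκm).mul hΨc.measurable).aestronglyMeasurable
  have hbΨm : AEStronglyMeasurable (fun ξ => (b ξ : ℂ) * Ψ ξ) volume :=
    ((Complex.measurable_ofReal.comp hbm).mul hΨc.measurable).aestronglyMeasurable
  have hκΨr : RapidOn (fun ξ => (κ ξ : ℂ) * Ψ ξ) Set.univ := fun N => by
    obtain ⟨D, hD0, hD⟩ := exists_nonneg_of_rapidOn hΨr N
    refine ⟨D + ‖Ψ 0‖, fun ξ _ => ?_⟩
    have hw := one_le_weight ξ
    rw [norm_mul, Complex.norm_real, Real.norm_eq_abs]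
    have h1 : |κ ξ| * ‖Ψ ξ‖ ≤ ‖Ψ ξ‖ := mul_le_of_le_one_left (norm_nonneg _) (hκ1 ξ)
    -- The conic neighbourhood does not contain the origin, where the value is bounded separately.
    by_cases hξ : ξ = 0
    · subst hξ
      simp only [norm_zero, add_zero, one_pow, div_one]
      linarith
    by_cases hκ : κ ξ = 0
    · rw [hκ, abs_zero, zero_mul]; positivity
    · exact h1.trans ((hD ξ (hκs ξ hξ hκ)).trans
        (div_le_div_of_nonneg_right (by linarith [norm_nonneg (Ψ 0)]) (by positivity)))
  obtain ⟨A₁, hA₁, hA₁s⟩ := exists_smooth_division hκΨm hκΨr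
  obtain ⟨A₂, hA₂⟩ := exists_functional_of_growth hbΨm (M := M) (C := B * C) (by positivity)
    fun ξ => by
      rw [norm_mul, Complex.norm_real, Real.norm_eq_abs, mul_assoc]
      exact mul_le_mul (hB ξ) (hgr ξ) (norm_nonneg _) hB0
  refine ⟨ofSchwartz A₁ + ofSchwartz A₂, ?_, fun x hx => ?_⟩
  · ext φ
    have hL : (-laplacian ψ) φ = -laplacian ψ φ := rfl
    rw [waveOp_apply, hL, laplacian_apply, hrep]
    change ofSchwartz A₁ (waveTest φ) + ofSchwartz A₂ (waveTest φ) = _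
    rw [ofSchwartz_apply, ofSchwartz_apply, hA₁, hA₂]
    set g := 𝓕⁻ (laplacianTest φ).toSchwartz with hg
    -- Off the null set `p = 0` the quotient by `p` cancels the factor `p` of the transform of
    -- `P(∂) φ`, whose values on the cone vanish.
    have h1 : (∫ ξ : R3, ((κ ξ : ℂ) * Ψ ξ) * ((‖ξ‖ ^ 2 : ℂ) *
        coneQuot (𝓕⁻ (waveTest φ).toSchwartz : 𝓢(R3, ℂ)) ξ)) =
        ∫ ξ, -(((κ ξ : ℂ) * Ψ ξ) * g ξ) := by
      refine integral_congr_ae ?_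
      filter_upwards [ae_symbol_ne_zero] with ξ hξ
      have hξ' : (symbol ξ : ℂ) ≠ 0 := Complex.ofReal_ne_zero.2 hξ
      rw [coneQuot, fourierInv_waveTest, fourierInv_waveTest, symbol_coneProj, hg,
        fourierInv_laplacianTest]
      push_cast
      field_simp
      ring
    have h2 : (∫ ξ : R3, ((b ξ : ℂ) * Ψ ξ) * 𝓕⁻ (waveTest φ).toSchwartz ξ) =
        ∫ ξ, -(((1 - κ ξ : ℝ) : ℂ) * Ψ ξ * g ξ) := by
      refine integral_congr_ae (Filter.Eventually.of_forall fun ξ => ?_)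
      have h3 : (b ξ : ℂ) * symbol ξ = (1 - κ ξ) * ‖ξ‖ ^ 2 := by exact_mod_cast hbκ ξ
      simp only
      rw [fourierInv_waveTest, hg, fourierInv_laplacianTest]
      push_cast
      linear_combination (Ψ ξ * (2 * (Real.pi : ℂ)) ^ 2 * 𝓕⁻ (Test.toSchwartz φ) ξ) * h3
    have hi1 : Integrable fun ξ => ((κ ξ : ℂ) * Ψ ξ) * g ξ :=
      integrable_mul_schwartz g hκΨm (A := C) (K := M) fun ξ => by
        rw [norm_mul, Complex.norm_real, Real.norm_eq_abs]
        exact (mul_le_of_le_one_left (norm_nonneg _) (hκ1 ξ)).trans (hgr ξ)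
    have hi0 : Integrable fun ξ => Ψ ξ * g ξ :=
      integrable_mul_schwartz g hΨc.aestronglyMeasurable hgr
    have hi2 : Integrable fun ξ => ((1 - κ ξ : ℝ) : ℂ) * Ψ ξ * g ξ := by
      refine (hi0.sub hi1).congr (Filter.Eventually.of_forall fun ξ => ?_)
      simp only [Pi.sub_apply]
      push_cast; ring
    rw [h1, h2, integral_neg, integral_neg, ← neg_add, ← integral_add hi1 hi2]
    congr 2; ext ξ
    push_cast; ring
  · by_contra hxψ
    simp only [singsupp, Set.mem_ofPred_eq, not_forall, not_not] at hxψ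
    obtain ⟨U, hU, hxU, hs⟩ := hxψ
    obtain ⟨θ, hθU, -, V, -, hxV, hθ1⟩ := exists_test_eq_one (isCompact_singleton (x := x)) hU
      (Set.singleton_subset_iff.2 hxU)
    have hr2 : RapidOn (locFT (ofSchwartz A₂) θ) Set.univ := by
      have h := rapidOn_multiplier hU hs θ₀ hθU hb hbhom hB
      have heq : locFT (ofSchwartz A₂) θ = fun η =>
          ∫ h, (b (η + h) * locFT ψ θ₀ (η + h)) * 𝓕⁻ θ.toSchwartz h := by
        ext η
        rw [locFT_ofSchwartz, hA₂, ← integral_add_left_eq_self _ η]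
        simp_rw [fourierInv_modulate, add_sub_cancel_left]
        rfl
      rwa [heq]
    have hr : RapidOn (locFT (ofSchwartz A₁ + ofSchwartz A₂) θ) Set.univ := by
      have := (hA₁s θ).add hr2
      rwa [← funext (add_locFT (ofSchwartz A₁) (ofSchwartz A₂) θ)] at this
    refine hx {y | θ y ≠ 0} (isOpen_ne_fun θ.contDiff.continuous continuous_const) ?_
      (isSmoothOn_of_rapidOn _ θ hr)
    simp [hθ1 x (hxV rfl)]

end QSM

theorem mainTheorem3 (ψ : QSM.Distr)
    (hψ : IsCompact (Distribution.dsupport ψ))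
    (hWF : QSM.WF ψ ∩ QSM.charSet = ∅) :
    ∃ χ : QSM.Distr,
      QSM.waveOp χ = -QSM.laplacian ψ ∧
      QSM.singsupp χ ⊆ QSM.singsupp ψ ∧
      IsCompact (QSM.singsupp χ) ∧
      IsCompact (QSM.singsupp ψ) := by
  obtain ⟨χ, hχ, hsub⟩ := QSM.exists_waveOp_eq ψ hψ hWF
  have hψs : IsCompact (QSM.singsupp ψ) :=
    hψ.of_isClosed_subset (isOpen_compl_iff.1 (QSM.isOpen_compl_singsupp ψ))
      (QSM.singsupp_subset_dsupport ψ)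
  exact ⟨χ, hχ, hsub,
    hψs.of_isClosed_subset (isOpen_compl_iff.1 (QSM.isOpen_compl_singsupp χ)) hsub, hψs⟩
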